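/- Let $\mathbb F_q$ be the finite field with $q$ elements, of odd characteristic $p$, let $\ell\neq p$ be an odd prime, $m\ge 1$, $n\ge 0$, and let $N=2\ell^mp^n$. A linear code $C\subseteq\mathbb F_q^N$ is negacyclic if $(-c_{N-1},c_0,\dots,c_{N-2})\in C$ whenever $(c_0,\dots,c_{N-1})\in C$, and LCD if $C\cap C^\perp=\{0\}$ for the Euclidean dual $C^\perp$. Words are identified with classes in $\mathbb F_q[X]/\langle X^N+1\rangle$ by $c\mapsto\sum_i c_iX^i$; each negacyclic code is then $\langle G\rangle$ for a unique monic divisor $G$ of $X^N+1$ in $\mathbb F_q[X]$, its generator polynomial. Notation. Let $f=\mathrm{ord}_\ell(q)$ be the multiplicative order of $q$ modulo $\ell$, let $\ell^s$ be the exact power of $\ell$ dividing $q^f-1$, and put $\lambda(r)=f\ell^{\max(r-s,0)}$, $\delta(r)=\phi(\ell^r)/\lambda(r)$, $e=\sum_{r=1}^m\delta(r)$. The $Q$-cyclotomic coset of $t$ modulo $\ell^m$ is $\{tQ^j: j\ge 0\}\subseteq\mathbb Z/\ell^m$. There are exactly $e+1$ $q$-cyclotomic cosets modulo $\ell^m$;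 let $\rho_0=0,\rho_1,\dots,\rho_e$ be any system of representatives of them. Let $g$ be any generator of $(\mathbb Z/\ell^m)^*$, and let $\eta$ be a primitive $\ell^m$-th root of unity in an extension field $K$ of $\mathbb F_q$. Let $M_t$ be the minimal polynomial of $\eta^t$ over $\mathbb F_q$, and let $N_t(X)=\prod_{s}(X-\eta^s)$ with $s$ running over the $q^2$-cyclotomic coset of $t$ modulo $\ell^m$. For a nonzero polynomial $h$ let $\hat h$ be the monic scalar multiple of $h$; thus $\hat h(aX)$ denotes the monic scalar multiple of $h(aX)$. If $q\equiv1\pmod 4$, let $\gamma\in\mathbb F_q$ be a primitive fourth root of unity, and let $\beta\in\mathbb F_q$ be an element with $\beta^{\ell^m}\gamma=1$ and $\beta^{-1}=-\beta$ (such $\beta$ exists). If $q\equiv3\pmod4$, let $\varsigma$ be a root of $X^2+1$ in $\mathbb F_{q^2}$, take $K\supseteq\mathbb F_{q^2}$, and let $\theta\in\mathbb F_{q^2}$ be an element with $\theta^{\ell^m}\varsigma=1$ and $\theta^{-1}=-\theta$ (such $\theta$ exists). Theorem. (i) If $q\equiv1\pmod4$, then there are exactly $2^{e+1}$ LCD negacyclic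 codes of length $N$ over $\mathbb F_q$, and their generator polynomials are exactly $$\prod_{i=0}^{e}\hat M_{\rho_i}(\beta X)^{\varepsilon_i}\hat M_{-\rho_i}(-\beta X)^{\varepsilon_i},\qquad \varepsilon_i\in\{0,p^n\}.$$ (ii) If $q\equiv3\pmod4$ and $f$ is odd, then there are exactly $2^{1+e/2}$ such codes (here $e$ is even), and their generator polynomials are exactly $$(X^2+1)^{\varepsilon_0}\prod_{r=1}^{m}\prod_{k=0}^{\delta(r)/2-1}I_{r,k}(X)^{\varepsilon^r_k}J_{r,k}(X)^{\varepsilon^r_k},\qquad \varepsilon_0,\varepsilon^r_k\in\{0,p^n\},$$ where $I_{r,k}(X)=\hat M_{\ell^{m-r}g^k}(\theta X)\hat M_{\ell^{m-r}g^k}(-\theta X)$ and $J_{r,k}(X)=\hat M_{-\ell^{m-r}g^k}(\theta X)\hat M_{-\ell^{m-r}g^k}(-\theta X)$. (iii) If $q\equiv3\pmod4$ and $f\equiv2\pmod4$, then there are exactly $2^{1+2e}$ such codes, and their generator polynomials are exactly $$(X^2+1)^{\varepsilon_0}\prod_{k=1}^{e}S_k(X)^{\varepsilon_k}T_k(X)^{\epsilon_k},\qquad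 \varepsilon_0,\varepsilon_k,\epsilon_k\in\{0,p^n\},$$ where $S_k(X)=\hat N_{\rho_k}(\theta X)\hat N_{\rho_kq}(-\theta X)$ and $T_k(X)=\hat N_{\rho_k}(-\theta X)\hat N_{\rho_kq}(\theta X)$. (iv) If $q\equiv3\pmod4$ and $f\equiv0\pmod4$, then there are exactly $2^{1+e}$ such codes, and their generator polynomials are exactly $$(X^2+1)^{\varepsilon_0}\prod_{k=1}^{e}S_k(X)^{\varepsilon_k}T_k(X)^{\varepsilon_k},\qquad \varepsilon_0,\varepsilon_k\in\{0,p^n\}.$$ In particular all the listed polynomials have their coefficients in $\mathbb F_q$. -/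

import Mathlib

open Polynomial

namespace NegacyclicLCD

section Codes

variable {F : Type*} [Field F] {N : ℕ}

/-- The `lam`-constacyclic shift `(c₀, …, c_{N-1}) ↦ (lam * c_{N-1}, c₀, …, c_{N-2})`. -/
def constacyclicShift (lam : F) (c : Fin N → F) : Fin N → F := fun i =>
  if (i : ℕ) = 0 then lam * c ⟨N - 1, by have := i.2; omega⟩
  else c ⟨(i : ℕ) - 1, by have := i.2; omega⟩

/-- A linear code of length `N` is a subspace of `F ^ N`; it is `lam`-constacyclic if it is closed
under the `lam`-constacyclic shift. -/
def IsConstacyclic (lam : F) (C : Submodule F (Fin N → F)) : Prop :=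
  ∀ c ∈ C, constacyclicShift lam c ∈ C

/-- Negacyclic codes are the `(-1)`-constacyclic codes. -/
def IsNegacyclic (C : Submodule F (Fin N → F)) : Prop := IsConstacyclic (-1 : F) C

/-- The Euclidean dual code. -/
def dualCode (C : Submodule F (Fin N → F)) : Submodule F (Fin N → F) where
  carrier := {u | ∀ v ∈ C, u ⬝ᵥ v = 0}
  add_mem' := by
    intro a b ha hb v hv
    rw [add_dotProduct, ha v hv, hb v hv, add_zero]
  zero_mem' := by
    intro v _
    exact zero_dotProduct v
  smul_mem' := by
    intro r a ha v hv
    rw [smul_dotProduct, ha v hv, smul_zero]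

/-- Linear complementary-dual codes: `C ∩ C^⊥ = {0}`. -/
def IsLCD (C : Submodule F (Fin N → F)) : Prop := C ⊓ dualCode C = ⊥

/-- The polynomial `c₀ + c₁ X + ⋯ + c_{N-1} X^{N-1}` of a word. -/
noncomputable def wordPoly (c : Fin N → F) : F[X] := ∑ i : Fin N, C (c i) * X ^ (i : ℕ)

/-- The code `⟨g⟩`: all words whose polynomial lies, modulo `X ^ N - lam`, in the ideal of
`F[X] / (X ^ N - lam)` generated by `g`. -/
noncomputable def generatedCode (N : ℕ) (lam : F) (g : F[X]) : Submodule F (Fin N → F) where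
  carrier := {c | Ideal.Quotient.mk (Ideal.span {X ^ N - C lam}) (wordPoly c) ∈
    Ideal.span {Ideal.Quotient.mk (Ideal.span {X ^ N - C lam}) g}}
  add_mem' := by
    intro a b ha hb
    have h : wordPoly (a + b) = wordPoly a + wordPoly b := by
      simp [wordPoly, add_mul, Finset.sum_add_distrib]
    simp only [Set.mem_ofPred_eq] at ha hb ⊢
    rw [h, map_add]
    exact Ideal.add_mem _ ha hb
  zero_mem' := by
    simp [wordPoly]
  smul_mem' := by
    intro r a ha
    have h : wordPoly (r • a) = C r * wordPoly a := by
      simp [wordPoly, Finset.mul_sum, mul_assoc]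
    simp only [Set.mem_ofPred_eq] at ha ⊢
    rw [h, map_mul]
    exact Ideal.mul_mem_left _ _ ha

/-- `G`, a polynomial over an extension `A` of `F`, has all its coefficients in `F`, and as a
polynomial over `F` it is the generator polynomial of the negacyclic code `C`: a monic divisor
of `X ^ N + 1` with `C = ⟨G⟩`. -/
def HasGeneratorPolynomial {A : Type*} [Field A] [Algebra F A]
    (C : Submodule F (Fin N → F)) (G : A[X]) : Prop :=
  ∃ g : F[X], g.map (algebraMap F A) = G ∧ g.Monic ∧ g ∣ X ^ N - Polynomial.C (-1 : F) ∧
    C = generatedCode N (-1 : F) g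

/-- The polynomials in `𝒢` are exactly the generator polynomials of the LCD negacyclic codes of
length `N` over `F`: each of them generates such a code, and each such code arises so. -/
def GeneratesLCDNegacyclic (F : Type*) [Field F] (N : ℕ) {A : Type*} [Field A] [Algebra F A]
    (𝒢 : Set A[X]) : Prop :=
  (∀ G ∈ 𝒢, ∃ C : Submodule F (Fin N → F),
    IsNegacyclic C ∧ IsLCD C ∧ HasGeneratorPolynomial C G) ∧
  (∀ C : Submodule F (Fin N → F), IsNegacyclic C → IsLCD C →
    ∃ G ∈ 𝒢, HasGeneratorPolynomial C G)

/-- The number of LCD negacyclic codes of length `N` over `F`. -/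
noncomputable def numLCDNegacyclic (F : Type*) [Field F] (N : ℕ) : ℕ :=
  Set.ncard {C : Submodule F (Fin N → F) | IsNegacyclic C ∧ IsLCD C}

end Codes

section Cosets

/-- `f = ord_ℓ(q)`. -/
noncomputable def ordMod (q l : ℕ) : ℕ := orderOf (q : ZMod l)

/-- `λ(r) = f ℓ^{max(r - s, 0)}`, where `ℓ^s` exactly divides `q^f - 1`. -/
noncomputable def lambdaOrd (q l r : ℕ) : ℕ :=
  ordMod q l * l ^ (r - padicValNat l (q ^ ordMod q l - 1))

/-- `δ(r) = φ(ℓ^r) / λ(r)`. -/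
noncomputable def deltaNum (q l r : ℕ) : ℕ := Nat.totient (l ^ r) / lambdaOrd q l r

/-- `e = δ(1) + ⋯ + δ(m)`. -/
noncomputable def eNum (q l m : ℕ) : ℕ := ∑ r ∈ Finset.Icc 1 m, deltaNum q l r

/-- The `Q`-cyclotomic coset of `t` modulo `M`. -/
def cyclotomicCoset (Q : ℕ) {M : ℕ} (t : ZMod M) : Set (ZMod M) :=
  {s | ∃ j : ℕ, s = t * (Q : ZMod M) ^ j}

/-- `ρ₀ = 0, ρ₁, …, ρ_e` represent all the distinct `q`-cyclotomic cosets modulo `M`. -/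
def IsCosetSystem (q : ℕ) {M e : ℕ} (ρ : Fin (e + 1) → ZMod M) : Prop :=
  ρ 0 = 0 ∧ ∀ t : ZMod M, ∃! i, t ∈ cyclotomicCoset q (ρ i)

end Cosets

section Polys

variable {K : Type*} [Field K]

/-- The monic polynomial `f̂` associated with `f`. -/
noncomputable def hat (f : K[X]) : K[X] := C f.leadingCoeff⁻¹ * f

/-- `f(aX)`. -/
noncomputable def substMul (f : K[X]) (a : K) : K[X] := f.comp (C a * X)

/-- `M_t`, the minimal polynomial of `η ^ t` over `F`. -/
noncomputable def mPoly (F : Type*) [Field F] [Algebra F K] (η : K) {M : ℕ} (t : ZMod M) : F[X] :=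
  minpoly F (η ^ t.val)

/-- `N_t`, the product of the `X - η ^ s` over the `q²`-cyclotomic coset of `t`. -/
noncomputable def nPoly (q : ℕ) (η : K) {M : ℕ} (t : ZMod M) : K[X] :=
  ∏ᶠ s ∈ cyclotomicCoset (q ^ 2) t, (X - C (η ^ s.val))

/-- `M̂_t(θX) M̂_t(-θX)`. -/
noncomputable def pairPoly (F : Type*) [Field F] [Algebra F K] (η θ : K) {M : ℕ}
    (t : ZMod M) : K[X] :=
  hat (substMul ((mPoly F η t).map (algebraMap F K)) θ) *
    hat (substMul ((mPoly F η t).map (algebraMap F K)) (-θ))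

/-- `N̂_t(θX) N̂_{tq}(-θX)`; this is `S_k` for `t = ρ_k`, and `T_k` is obtained from it by
replacing `θ` with `-θ`. -/
noncomputable def sPoly (q : ℕ) (η θ : K) {M : ℕ} (t : ZMod M) : K[X] :=
  hat (substMul (nPoly q η t) θ) * hat (substMul (nPoly q η (t * (q : ZMod M))) (-θ))

/-- The generator polynomials for `q ≡ 1 (mod 4)`. -/
def generatorsOne (F : Type*) [Field F] [Algebra F K] (η : K) (β : F) {M e : ℕ}
    (ρ : Fin (e + 1) → ZMod M) (P : ℕ) : Set F[X] :=
  {G | ∃ ε : Fin (e + 1) → ℕ, (∀ i, ε i = 0 ∨ ε i = P) ∧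
    G = ∏ i, hat (substMul (mPoly F η (ρ i)) β) ^ ε i *
      hat (substMul (mPoly F η (-ρ i)) (-β)) ^ ε i}

/-- The generator polynomials for `q ≡ 3 (mod 4)` and `f` odd. -/
def generatorsOdd (F : Type*) [Field F] [Algebra F K] (q l m : ℕ) (η θ : K)
    (g : (ZMod (l ^ m))ˣ) (P : ℕ) : Set K[X] :=
  {G | ∃ (ε₀ : ℕ) (ε : ℕ → ℕ → ℕ), (ε₀ = 0 ∨ ε₀ = P) ∧ (∀ r k, ε r k = 0 ∨ ε r k = P) ∧
    G = (X ^ 2 + 1) ^ ε₀ * ∏ r ∈ Finset.Icc 1 m, ∏ k ∈ Finset.range (deltaNum q l r / 2),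
      pairPoly F η θ ((l : ZMod (l ^ m)) ^ (m - r) * (g : ZMod (l ^ m)) ^ k) ^ ε r k *
      pairPoly F η θ (-((l : ZMod (l ^ m)) ^ (m - r) * (g : ZMod (l ^ m)) ^ k)) ^ ε r k}

/-- The generator polynomials for `q ≡ 3 (mod 4)` and `f ≡ 2 (mod 4)`. -/
def generatorsTwo (q : ℕ) (η θ : K) {M e : ℕ} (ρ : Fin (e + 1) → ZMod M) (P : ℕ) : Set K[X] :=
  {G | ∃ (ε₀ : ℕ) (ε ε' : Fin e → ℕ), (ε₀ = 0 ∨ ε₀ = P) ∧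
    (∀ k, ε k = 0 ∨ ε k = P) ∧ (∀ k, ε' k = 0 ∨ ε' k = P) ∧
    G = (X ^ 2 + 1) ^ ε₀ * ∏ k : Fin e,
      sPoly q η θ (ρ k.succ) ^ ε k * sPoly q η (-θ) (ρ k.succ) ^ ε' k}

/-- The generator polynomials for `q ≡ 3 (mod 4)` and `f ≡ 0 (mod 4)`. -/
def generatorsZero (q : ℕ) (η θ : K) {M e : ℕ} (ρ : Fin (e + 1) → ZMod M) (P : ℕ) : Set K[X] :=
  {G | ∃ (ε₀ : ℕ) (ε : Fin e → ℕ), (ε₀ = 0 ∨ ε₀ = P) ∧ (∀ k, ε k = 0 ∨ ε k = P) ∧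
    G = (X ^ 2 + 1) ^ ε₀ * ∏ k : Fin e,
      sPoly q η θ (ρ k.succ) ^ ε k * sPoly q η (-θ) (ρ k.succ) ^ ε k}

/-- `β` is chosen with `β ^ L * γ = 1` and `β⁻¹ = -β`. -/
def IsTwist (L : ℕ) (γ β : K) : Prop := β ^ L * γ = 1 ∧ β⁻¹ = -β

end Polys

end NegacyclicLCD

namespace NegacyclicLCD

/-! ### Constacyclic codes as polynomial ideals -/

section Words

variable {F : Type*} [Field F] {N : ℕ}

/-! Put `M = l ^ m`. In characteristic `p`, `X ^ N + 1 = (X ^ (2 * M) + 1) ^ (p ^ n)`, and the inner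
polynomial has the `2 * M` distinct roots `(±θ)⁻¹ * η ^ s` with `s` in `ZMod M`, where `θ ^ 2 = -1`.

Let `g * h = X ^ N + 1`. The words common to `⟨g⟩` and its dual are those divisible by both `g` and
the reciprocal of `h`. The degrees of these two add up to `N`, so the code is LCD exactly when they
are coprime (`isLCD_generatedCode_iff`). Then the inverse of a root of `g` is not a root of `h`,
hence is a root of `g`. Applied twice, this shows that `g` and `h` share no root, so `g` carries
each of its roots with the full multiplicity `p ^ n`. Thus LCD codes correspond to the sets of roots
stable under inversion and, since `g` has coefficients in `F`, under Frobenius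
(`RootData.exists_code`, `RootData.exists_stable`). Such sets are the unions of orbits: the number
of codes is 2 to the number of orbits, and the generator polynomials are the products of `p ^ n`-th
powers of orbit polynomials (`RootData.IsOrbitPartition.generates`).

It remains to find the orbits on pairs (sign, `s`). Inversion flips the sign and negates `s`.
Frobenius multiplies `s` by `q`, and keeps the sign if `q ≡ 1`, flips it if `q ≡ 3` modulo 4. (i)
With the sign kept, an orbit is the coset of `t` under one sign and the coset of `-t` under the
other. (ii) If `f` is odd, `q` has odd order modulo `M`, so the sign varies independently of `s`; an
orbit is both signs times the cosets of `t` and `-t`, which differ for `t ≠ 0`. If `f` is even, `-1`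
is a power of `q` with exponent of the parity of `f / 2` (`pow_half_lambdaOrd`), and each nonzero
`q`-coset splits into two `q²`-cosets. (iii) For odd exponent, inversion is a power of Frobenius,
and there are two orbits over each nonzero coset. (iv) For even exponent, inversion combined with a
power of Frobenius flips the sign alone, and an orbit is both signs times one coset. -/

theorem coeff_wordPoly (c : Fin N → F) (j : ℕ) :
    (wordPoly c).coeff j = if h : j < N then c ⟨j, h⟩ else 0 := by
  simp only [wordPoly, finsetSum_coeff, coeff_C_mul, coeff_X_pow]
  split_ifs with h
  · rw [Finset.sum_eq_single ⟨j, h⟩]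
    · simp
    · intro b _ hb
      have : j ≠ (b : ℕ) := fun e => hb (Fin.ext e.symm)
      simp [this]
    · simp
  · refine Finset.sum_eq_zero fun i _ => ?_
    have : j ≠ (i : ℕ) := by have := i.2; omega
    simp [this]

theorem degree_wordPoly_lt (c : Fin N → F) : (wordPoly c).degree < N := by
  rw [degree_lt_iff_coeff_zero]
  intro j hj
  rw [coeff_wordPoly, dif_neg (by simpa using hj)]

theorem wordPoly_injective : Function.Injective (wordPoly : (Fin N → F) → F[X]) := by
  intro a b h
  funext i
  have := congrArg (fun p => p.coeff i) h
  simpa [coeff_wordPoly] using this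

theorem wordPoly_coeff {f : F[X]} (hf : f.degree < N) :
    wordPoly (fun i : Fin N => f.coeff i) = f := by
  ext j
  rw [coeff_wordPoly]
  split_ifs with h
  · rfl
  · exact ((degree_lt_iff_coeff_zero f N).1 hf j (not_lt.1 h)).symm

theorem wordPoly_add (a b : Fin N → F) : wordPoly (a + b) = wordPoly a + wordPoly b := by
  simp [wordPoly, add_mul, Finset.sum_add_distrib]

theorem wordPoly_smul (r : F) (a : Fin N → F) : wordPoly (r • a) = C r * wordPoly a := by
  simp [wordPoly, Finset.mul_sum, mul_assoc]

theorem wordPoly_zero : wordPoly (0 : Fin N → F) = 0 := by simp [wordPoly]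

/-- Since `g` divides the modulus, reduction does not affect divisibility by `g`, and the quotient
ring can be dropped. -/
theorem mem_generatedCode {lam : F} {g : F[X]} (hg : g ∣ X ^ N - C lam) (c : Fin N → F) :
    c ∈ generatedCode N lam g ↔ g ∣ wordPoly c := by
  change Ideal.Quotient.mk (Ideal.span {X ^ N - C lam}) (wordPoly c) ∈
    Ideal.span {Ideal.Quotient.mk (Ideal.span {X ^ N - C lam}) g} ↔ _
  rw [Ideal.mem_span_singleton]
  constructor
  · rintro ⟨a, ha⟩
    obtain ⟨a, rfl⟩ := Ideal.Quotient.mk_surjective a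
    rw [← map_mul, Ideal.Quotient.eq, Ideal.mem_span_singleton] at ha
    exact (dvd_sub_left (Dvd.intro a rfl)).1 (hg.trans ha)
  · exact fun h => map_dvd _ h

theorem dvd_X_mul_wordPoly_sub (hN : 0 < N) (lam : F) (c : Fin N → F) :
    X ^ N - C lam ∣ X * wordPoly c - wordPoly (constacyclicShift lam c) := by
  -- The shift is multiplication by `X`, except that the last letter wraps around: `X ^ N` is
  -- replaced by `lam`.
  refine ⟨C (c ⟨N - 1, by omega⟩), ?_⟩
  ext j
  rw [coeff_sub, coeff_mul_C, coeff_sub, coeff_wordPoly]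
  rcases j with _ | j
  · simp [hN, constacyclicShift, hN.ne, coeff_X_pow]
  · rw [coeff_X_mul, coeff_wordPoly, coeff_X_pow, coeff_C_succ, sub_zero]
    rcases lt_trichotomy (j + 1) N with h | h | h
    · rw [dif_pos h, dif_pos (by omega), if_neg h.ne]
      simp [constacyclicShift]
    · subst h
      simp
    · rw [dif_neg (by omega), dif_neg (by omega), if_neg (by omega)]
      simp

theorem monic_X_pow_sub (hN : 0 < N) (lam : F) : (X ^ N - C lam : F[X]).Monic :=
  monic_X_pow_sub_C lam hN.ne'

theorem eq_zero_of_dvd_of_degree_lt {lam : F} (hN : 0 < N) {f : F[X]}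
    (h : X ^ N - C lam ∣ f) (hf : f.degree < N) : f = 0 := by
  refine Polynomial.eq_zero_of_dvd_of_degree_lt h ?_
  rwa [degree_X_pow_sub_C hN]

theorem isConstacyclic_generatedCode (hN : 0 < N) {lam : F} {g : F[X]}
    (hg : g ∣ X ^ N - C lam) : IsConstacyclic lam (generatedCode N lam g) := by
  intro c hc
  rw [mem_generatedCode hg] at hc ⊢
  exact (dvd_sub_right (hc.mul_left X)).1 (hg.trans (dvd_X_mul_wordPoly_sub hN lam c))

theorem dvd_of_generatedCode_le (hN : 0 < N) {lam : F} {g g' : F[X]}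
    (hg : g ∣ X ^ N - C lam) (hm : g.Monic) (hg' : g' ∣ X ^ N - C lam)
    (h : generatedCode N lam g ≤ generatedCode N lam g') : g' ∣ g := by
  have hle : g.natDegree ≤ N := by
    simpa using natDegree_le_of_dvd hg (monic_X_pow_sub hN lam).ne_zero
  -- If `deg g < N`, then `g` is itself the polynomial of a codeword. Otherwise `g` is the whole
  -- modulus and its code is zero.
  rcases hle.lt_or_eq with hlt | heq
  · have hw := wordPoly_coeff (N := N) (f := g)
      ((degree_lt_iff_coeff_zero g N).2 fun j hj =>
        coeff_eq_zero_of_natDegree_lt (hlt.trans_le hj))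
    rw [← hw]
    exact (mem_generatedCode hg' _).1 (h ((mem_generatedCode hg _).2 (by rw [hw])))
  · have : g = X ^ N - C lam :=
      (eq_of_monic_of_dvd_of_natDegree_le hm (monic_X_pow_sub hN lam) hg (by simp [heq])).symm
    rwa [this]

theorem generatedCode_injective (hN : 0 < N) {lam : F} {g g' : F[X]}
    (hg : g ∣ X ^ N - C lam) (hm : g.Monic) (hg' : g' ∣ X ^ N - C lam) (hm' : g'.Monic)
    (h : generatedCode N lam g = generatedCode N lam g') : g = g' :=
  eq_of_monic_of_associated hm hm' (associated_of_dvd_dvd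
    (dvd_of_generatedCode_le hN hg' hm' hg h.ge) (dvd_of_generatedCode_le hN hg hm hg' h.le))

/-- The preimage `I` of the code in `F[X]` is an ideal because the shift acts as `X`. As `F[X]` is
principal, `I` has a generator, which is then made monic; it divides the modulus because the modulus
lies in `I`. -/
theorem exists_generator (hN : 0 < N) {lam : F} {D : Submodule F (Fin N → F)}
    (hD : IsConstacyclic lam D) :
    ∃ g : F[X], g.Monic ∧ g ∣ X ^ N - C lam ∧ D = generatedCode N lam g := by
  let I : Ideal F[X] :=
    { carrier := {f | ∃ c ∈ D, X ^ N - C lam ∣ f - wordPoly c}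
      add_mem' := by
        rintro a b ⟨c, hc, h⟩ ⟨d, hd, h'⟩
        refine ⟨c + d, D.add_mem hc hd, ?_⟩
        rw [wordPoly_add, add_sub_add_comm]
        exact dvd_add h h'
      zero_mem' := ⟨0, D.zero_mem, by simp [wordPoly_zero]⟩
      smul_mem' := by
        have hX : ∀ f : F[X], (∃ c ∈ D, X ^ N - C lam ∣ f - wordPoly c) →
            ∃ c ∈ D, X ^ N - C lam ∣ X * f - wordPoly c := by
          rintro f ⟨c, hc, h⟩
          refine ⟨_, hD c hc, ?_⟩
          have := dvd_add (h.mul_left X) (dvd_X_mul_wordPoly_sub hN lam c)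
          convert this using 1
          ring
        intro p f hf
        simp only [smul_eq_mul]
        induction p using Polynomial.induction_on generalizing f with
        | C a =>
          obtain ⟨c, hc, h⟩ := hf
          refine ⟨a • c, D.smul_mem a hc, ?_⟩
          rw [wordPoly_smul, ← mul_sub]
          exact h.mul_left _
        | add p r hp hr =>
          obtain ⟨c, hc, h⟩ := hp hf
          obtain ⟨d, hd, h'⟩ := hr hf
          refine ⟨c + d, D.add_mem hc hd, ?_⟩
          rw [wordPoly_add, add_mul, add_sub_add_comm]
          exact dvd_add h h'
        | monomial k a ih =>
          have := ih (hX f hf)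
          rwa [pow_succ, ← mul_assoc, mul_assoc _ X f] }
  have hI : ∀ f, f ∈ I ↔ ∃ c ∈ D, X ^ N - C lam ∣ f - wordPoly c := fun f => Iff.rfl
  have hW : X ^ N - C lam ∈ I := (hI _).2 ⟨0, D.zero_mem, by simp [wordPoly_zero]⟩
  have hgen : ∀ f, Submodule.IsPrincipal.generator I ∣ f ↔ f ∈ I := fun f =>
    (Submodule.IsPrincipal.mem_iff_generator_dvd I).symm
  set g₀ := Submodule.IsPrincipal.generator I
  have hg₀ : g₀ ≠ 0 := by
    intro h
    have := (hgen _).2 hW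
    rw [h, zero_dvd_iff] at this
    exact (monic_X_pow_sub hN lam).ne_zero this
  have hass : ∀ f, g₀ * C g₀.leadingCoeff⁻¹ ∣ f ↔ f ∈ I := fun f => by
    rw [← hgen]
    exact ((associated_mul_unit_right g₀ _ (isUnit_C.2
      (inv_ne_zero (leadingCoeff_ne_zero.2 hg₀)).isUnit)).dvd_iff_dvd_left).symm
  have hdvd := (hass _).2 hW
  refine ⟨g₀ * C g₀.leadingCoeff⁻¹, monic_mul_leadingCoeff_inv hg₀, hdvd, ?_⟩
  ext c
  rw [mem_generatedCode hdvd, hass, hI]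
  refine ⟨fun hc => ⟨c, hc, by simp⟩, ?_⟩
  rintro ⟨d, hd, h⟩
  have := eq_zero_of_dvd_of_degree_lt hN h
    ((degree_sub_le _ _).trans_lt (max_lt (degree_wordPoly_lt c) (degree_wordPoly_lt d)))
  rwa [wordPoly_injective (sub_eq_zero.1 this)]

end Words

/-! ### The dual code and the LCD criterion -/

section Duality

variable {F : Type*} [Field F] {N : ℕ}

/-- Reversing one word turns the dot product into a convolution, read off in degree `N - 1`. -/
theorem coeff_reflect_wordPoly_mul (hN : 0 < N) (u v : Fin N → F) :
    (reflect (N - 1) (wordPoly u) * wordPoly v).coeff (N - 1) = u ⬝ᵥ v := by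
  rw [mul_comm, coeff_mul, Finset.Nat.sum_antidiagonal_eq_sum_range_succ
    (fun i j => (wordPoly v).coeff i * (reflect (N - 1) (wordPoly u)).coeff j),
    Nat.succ_eq_add_one, Nat.sub_add_cancel hN, ← Fin.sum_univ_eq_sum_range
    (fun i => (wordPoly v).coeff i * (reflect (N - 1) (wordPoly u)).coeff (N - 1 - i))]
  refine Finset.sum_congr rfl fun i _ => ?_
  have hi := i.2
  rw [coeff_reflect, revAt_le (by omega), coeff_wordPoly, coeff_wordPoly, dif_pos hi,
    dif_pos (by omega), mul_comm]
  congr 2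
  ext
  simp only
  omega

/-- The quotient `k` has degree at most `N - 2`, so `X ^ N * k` lives in degrees at least `N` and
`lam * k` below `N - 1`: neither reaches degree `N - 1`. -/
theorem coeff_eq_of_dvd_sub {lam : F} (hN : 0 < N) {a b : F[X]} (h : X ^ N - C lam ∣ a - b)
    (ha : a.natDegree ≤ 2 * N - 2) (hb : b.natDegree ≤ 2 * N - 2) :
    a.coeff (N - 1) = b.coeff (N - 1) := by
  obtain ⟨k, hk⟩ := h
  rw [← sub_eq_zero, ← coeff_sub, hk]
  rcases eq_or_ne k 0 with rfl | hk0
  · simp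
  have hd : N + k.natDegree ≤ 2 * N - 2 := by
    have h1 : (a - b).natDegree = N + k.natDegree := by
      rw [hk, natDegree_mul (monic_X_pow_sub hN lam).ne_zero hk0, natDegree_X_pow_sub_C]
    rw [← h1]
    exact (natDegree_sub_le _ _).trans (max_le ha hb)
  rw [sub_mul, coeff_sub, coeff_C_mul, coeff_X_pow_mul', if_neg (by omega),
    coeff_eq_zero_of_natDegree_lt (by omega : k.natDegree < N - 1)]
  simp

theorem natDegree_wordPoly_le (c : Fin N → F) : (wordPoly c).natDegree ≤ N - 1 := by
  rw [natDegree_le_iff_coeff_eq_zero]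
  intro j hj
  rw [coeff_wordPoly, dif_neg (by omega)]

theorem natDegree_reflect_wordPoly_le (c : Fin N → F) :
    (reflect (N - 1) (wordPoly c)).natDegree ≤ N - 1 :=
  natDegree_reflect_le.trans (max_le le_rfl (natDegree_wordPoly_le c))

/-- The dual of the code generated by `g` is described by the check polynomial `h`. -/
theorem mem_dualCode_generatedCode (hN : 0 < N) {lam : F} {g h : F[X]}
    (hgh : g * h = X ^ N - C lam) (u : Fin N → F) :
    u ∈ dualCode (generatedCode N lam g) ↔ h ∣ reflect (N - 1) (wordPoly u) := by
  have hg : g ∣ X ^ N - C lam := ⟨h, hgh.symm⟩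
  have hW := (monic_X_pow_sub hN lam)
  have hg0 : g ≠ 0 := by
    rintro rfl
    exact hW.ne_zero (by rw [← hgh, zero_mul])
  have hdeg := natDegree_wordPoly_le u
  set u' := reflect (N - 1) (wordPoly u) with hu'
  have hu'd : u'.natDegree ≤ N - 1 := natDegree_reflect_wordPoly_le u
  change (∀ v ∈ generatedCode N lam g, u ⬝ᵥ v = 0) ↔ _
  constructor
  · intro hu
    suffices X ^ N - C lam ∣ u' * g by
      rw [← hgh, mul_comm u' g] at this
      exact (mul_dvd_mul_iff_left hg0).1 this
    rw [← modByMonic_eq_zero_iff_dvd hW]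
    by_contra hr
    set r := (u' * g) %ₘ (X ^ N - C lam) with hrdef
    have hrd : r.natDegree < N := by
      have := natDegree_modByMonic_lt (u' * g) hW (by
        intro h1
        have h2 := congrArg natDegree h1
        rw [natDegree_X_pow_sub_C, natDegree_one] at h2
        omega)
      rwa [natDegree_X_pow_sub_C] at this
    -- The power of `X` moves the leading coefficient of `r` to degree `N - 1`. The codeword `w`
    -- therefore has that coefficient as its dot product with `u`, which would have to vanish.
    set w := (X ^ (N - 1 - r.natDegree) * g) %ₘ (X ^ N - C lam) with hw
    have hwd : w.degree < N := by
      have := degree_modByMonic_lt (X ^ (N - 1 - r.natDegree) * g) hW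
      rwa [degree_X_pow_sub_C hN] at this
    have hwW : X ^ N - C lam ∣ X ^ (N - 1 - r.natDegree) * g - w := by
      rw [hw, modByMonic_eq_sub_mul_div]
      simp
    have hrW : X ^ N - C lam ∣ u' * g - r := by
      rw [hrdef, modByMonic_eq_sub_mul_div]
      simp
    have hwg : g ∣ w := (dvd_sub_right (Dvd.intro_left _ rfl)).1 (hg.trans hwW)
    have hww := wordPoly_coeff hwd
    have h0 := hu (fun i => w.coeff i) ((mem_generatedCode hg _).2 (by rwa [hww]))
    rw [← coeff_reflect_wordPoly_mul hN, hww, ← hu',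
      coeff_eq_of_dvd_sub (lam := lam) hN (b := X ^ (N - 1 - r.natDegree) * r)] at h0
    · rw [coeff_X_pow_mul', if_pos (by omega),
        show N - 1 - (N - 1 - r.natDegree) = r.natDegree by omega] at h0
      exact hr (leadingCoeff_eq_zero.1 h0)
    · have := dvd_sub (hrW.mul_left (X ^ (N - 1 - r.natDegree))) (hwW.mul_left u')
      convert this using 1
      ring
    · have : w.natDegree ≤ N - 1 := by
        rw [natDegree_le_iff_coeff_eq_zero]
        intro j hj
        exact (degree_lt_iff_coeff_zero w N).1 hwd j (by omega)
      exact natDegree_mul_le.trans (by omega)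
    · exact natDegree_mul_le.trans (by rw [natDegree_X_pow]; omega)
  · rintro ⟨b, hb⟩ v hv
    rw [mem_generatedCode hg] at hv
    obtain ⟨a, ha⟩ := hv
    rw [← coeff_reflect_wordPoly_mul hN, ← hu', ← coeff_zero (N - 1)]
    refine coeff_eq_of_dvd_sub (lam := lam) hN ?_ ?_ (by simp)
    · rw [sub_zero, ha, hb, ← hgh]
      exact ⟨b * a, by ring⟩
    · exact natDegree_mul_le.trans (by have := natDegree_wordPoly_le v; omega)

theorem natDegree_reverse_of_coeff_zero {h : F[X]} (h0 : h.coeff 0 ≠ 0) :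
    h.reverse.natDegree = h.natDegree := by
  rw [reverse_natDegree, natTrailingDegree_eq_zero.2 (Or.inr h0), Nat.sub_zero]

theorem reverse_reverse_of_coeff_zero {h : F[X]} (h0 : h.coeff 0 ≠ 0) :
    h.reverse.reverse = h := by
  unfold reverse
  have := natDegree_reverse_of_coeff_zero h0
  unfold reverse at this
  rw [this, reflect_reflect]

theorem reverse_dvd_of_dvd_reflect {h u : F[X]} {k : ℕ}
    (hu : u.natDegree ≤ k) (hd : h ∣ reflect k u) : h.reverse ∣ u := by
  rcases eq_or_ne u 0 with rfl | hu0
  · exact dvd_zero _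
  obtain ⟨b, hb⟩ := hd
  have hne : reflect k u ≠ 0 := by rwa [Ne, reflect_eq_zero_iff]
  rw [hb] at hne
  have hdeg : h.natDegree + b.natDegree ≤ k := by
    rw [← natDegree_mul (left_ne_zero_of_mul hne) (right_ne_zero_of_mul hne), ← hb]
    exact natDegree_reflect_le.trans (max_le le_rfl hu)
  -- Reflection is multiplicative when the lengths add up, here `deg h` and `k - deg h`.
  refine ⟨reflect (k - h.natDegree) b, ?_⟩
  rw [reverse, ← reflect_mul _ _ le_rfl (by omega), ← hb,
    Nat.add_sub_cancel' (by omega), reflect_reflect]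

theorem dvd_reflect_iff {h u : F[X]} (h0 : h.coeff 0 ≠ 0) {k : ℕ} (hu : u.natDegree ≤ k) :
    h ∣ reflect k u ↔ h.reverse ∣ u := by
  refine ⟨reverse_dvd_of_dvd_reflect hu, fun hd => ?_⟩
  rw [← reverse_reverse_of_coeff_zero h0]
  exact reverse_dvd_of_dvd_reflect (k := k) (natDegree_reflect_le.trans (max_le le_rfl hu))
    (by rwa [reflect_reflect])

/-- A constacyclic code is LCD if and only if its generator polynomial is coprime to the
reciprocal of its check polynomial. -/
theorem isLCD_generatedCode_iff (hN : 0 < N) {lam : F} (hlam : lam ≠ 0) {g h : F[X]}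
    (hgh : g * h = X ^ N - C lam) :
    IsLCD (generatedCode N lam g) ↔ IsCoprime g h.reverse := by
  have hg : g ∣ X ^ N - C lam := ⟨h, hgh.symm⟩
  have hW := (monic_X_pow_sub hN lam)
  have hprod : g * h ≠ 0 := hgh ▸ hW.ne_zero
  have h0 : h.coeff 0 ≠ 0 := by
    intro h0
    have := congrArg (fun p => p.coeff 0) hgh
    simp [mul_coeff_zero, h0, coeff_X_pow, hN.ne, eq_comm, hlam] at this
  have hdeg : g.natDegree + h.reverse.natDegree = N := by
    rw [natDegree_reverse_of_coeff_zero h0,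
      ← natDegree_mul (left_ne_zero_of_mul hprod) (right_ne_zero_of_mul hprod), hgh,
      natDegree_X_pow_sub_C]
  have hmem : ∀ u : Fin N → F, u ∈ generatedCode N lam g ⊓ dualCode (generatedCode N lam g) ↔
      g ∣ wordPoly u ∧ h.reverse ∣ wordPoly u := by
    intro u
    rw [Submodule.mem_inf, mem_generatedCode hg, mem_dualCode_generatedCode hN hgh,
      dvd_reflect_iff h0 (natDegree_wordPoly_le u)]
  have hr0 : h.reverse ≠ 0 := by
    rw [Ne, reverse_eq_zero]
    exact right_ne_zero_of_mul hprod
  have hg0 := left_ne_zero_of_mul hprod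
  rw [IsLCD, Submodule.eq_bot_iff]
  constructor
  · intro hu
    classical
    by_contra hc
    rw [← EuclideanDomain.gcd_isUnit_iff] at hc
    obtain ⟨a, ha⟩ := EuclideanDomain.gcd_dvd_left g h.reverse
    obtain ⟨b, hb⟩ := EuclideanDomain.gcd_dvd_right g h.reverse
    set d := EuclideanDomain.gcd g h.reverse
    have hd0 : d ≠ 0 := by
      intro h
      rw [h, zero_mul] at ha
      exact hg0 ha
    have hb0 : b ≠ 0 := by
      intro h
      rw [h, mul_zero] at hb
      exact hr0 hb
    have hdpos : 0 < d.natDegree := natDegree_pos_iff_degree_pos.2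
      (degree_pos_of_ne_zero_of_nonunit hd0 hc)
    -- `g * b` is a least common multiple of `g` and `h.reverse`. Their degrees add up to `N` and
    -- the gcd `d` is not constant, so it gives a nonzero word in the intersection.
    have hw : (g * b).degree < N := by
      rw [degree_eq_natDegree (mul_ne_zero hg0 hb0), Nat.cast_lt, natDegree_mul hg0 hb0]
      rw [hb, natDegree_mul hd0 hb0] at hdeg
      omega
    have h1 := hu (fun i => (g * b).coeff i) ((hmem _).2 (by
      rw [wordPoly_coeff hw]
      refine ⟨Dvd.intro _ rfl, a, ?_⟩
      rw [hb]
      nth_rw 1 [ha]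
      ring))
    have h2 := wordPoly_coeff hw
    rw [h1, wordPoly_zero] at h2
    exact mul_ne_zero hg0 hb0 h2.symm
  · intro hc u hu
    obtain ⟨h1, h2⟩ := (hmem u).1 hu
    apply wordPoly_injective
    rw [wordPoly_zero]
    refine Polynomial.eq_zero_of_dvd_of_degree_lt (hc.mul_dvd h1 h2) ?_
    rw [degree_eq_natDegree (mul_ne_zero hg0 hr0), natDegree_mul hg0 hr0, hdeg]
    exact degree_wordPoly_lt u

end Duality

end NegacyclicLCD

namespace NegacyclicLCD

/-! ### Polynomials with prescribed simple roots -/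

section RootPoly

variable {K Z : Type*} [Field K]

/-- The product of the `X - E z` over `z ∈ S`. -/
noncomputable def rootPoly (E : Z → K) (S : Set Z) : K[X] := ∏ᶠ z ∈ S, (X - C (E z))

variable [Finite Z] {E : Z → K}

theorem rootPoly_eq_prod (E : Z → K) (S : Set Z) :
    rootPoly E S = ∏ z ∈ (Set.toFinite S).toFinset, (X - C (E z)) :=
  finprod_mem_eq_finite_toFinset_prod _ _

theorem monic_rootPoly (E : Z → K) (S : Set Z) : (rootPoly E S).Monic := by
  rw [rootPoly_eq_prod]
  exact monic_prod_of_monic _ _ fun z _ => monic_X_sub_C _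

theorem eval_rootPoly_eq_zero_iff (S : Set Z) (x : K) :
    (rootPoly E S).eval x = 0 ↔ ∃ z ∈ S, x = E z := by
  rw [rootPoly_eq_prod, eval_prod, Finset.prod_eq_zero_iff]
  simp [sub_eq_zero]

theorem eval_rootPoly_eq_zero_iff_mem (hE : Function.Injective E) (S : Set Z) (z : Z) :
    (rootPoly E S).eval (E z) = 0 ↔ z ∈ S := by
  rw [eval_rootPoly_eq_zero_iff]
  exact ⟨fun ⟨w, hw, h⟩ => hE h ▸ hw, fun h => ⟨z, h, rfl⟩⟩

theorem isCoprime_X_sub_C {f : K[X]} {x : K} (h : f.eval x ≠ 0) : IsCoprime (X - C x) f :=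
  (irreducible_X_sub_C x).coprime_iff_not_dvd.2 fun hd => h (dvd_iff_isRoot.1 hd)

theorem isCoprime_rootPoly {f : K[X]} {S : Set Z} (h : ∀ z ∈ S, f.eval (E z) ≠ 0) :
    IsCoprime (rootPoly E S) f := by
  rw [rootPoly_eq_prod]
  exact IsCoprime.prod_left fun z hz => isCoprime_X_sub_C (h z (by simpa using hz))

theorem rootPoly_pow_dvd (hE : Function.Injective E) {f : K[X]} {S : Set Z} {P : ℕ}
    (h : ∀ z ∈ S, (X - C (E z)) ^ P ∣ f) : rootPoly E S ^ P ∣ f := by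
  rw [rootPoly_eq_prod, ← Finset.prod_pow]
  refine Finset.prod_dvd_of_coprime ?_ fun z hz => h z (by simpa using hz)
  intro z _ w _ hzw
  refine IsCoprime.pow (isCoprime_X_sub_C ?_)
  simpa [sub_eq_zero] using fun h => hzw (hE h)

theorem rootPoly_mul_compl (E : Z → K) (S : Set Z) :
    rootPoly E S * rootPoly E Sᶜ = rootPoly E Set.univ := by
  unfold rootPoly
  rw [← finprod_mem_union disjoint_compl_right (Set.toFinite _) (Set.toFinite _),
    Set.union_compl_self]

theorem rootPoly_union (E : Z → K) {S T : Set Z} (h : Disjoint S T) :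
    rootPoly E (S ∪ T) = rootPoly E S * rootPoly E T :=
  finprod_mem_union h (Set.toFinite _) (Set.toFinite _)

omit [Finite Z] in
theorem rootPoly_image {Y : Type*} {φ : Y → Z} (hφ : Function.Injective φ) (S : Set Y) :
    rootPoly E (φ '' S) = rootPoly (E ∘ φ) S := by
  unfold rootPoly
  rw [finprod_mem_image hφ.injOn]
  rfl

theorem natDegree_rootPoly (E : Z → K) (S : Set Z) :
    (rootPoly E S).natDegree = S.ncard := by
  rw [rootPoly_eq_prod, natDegree_prod_of_monic _ _ fun z _ => monic_X_sub_C _,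
    Set.ncard_eq_toFinset_card S]
  simp

end RootPoly

/-! ### Descent to the base field -/

section Descent

variable {F K Z : Type*} [Field F] [Fintype F] [Field K] [Algebra F K]

/-- `X ^ q - X` is the product of the `X - a` over `a` in `F`; evaluating at `x` makes one factor
vanish. -/
theorem mem_range_algebraMap_of_pow_card {x : K} (hx : x ^ Fintype.card F = x) :
    x ∈ Set.range (algebraMap F K) := by
  have hlt := Fintype.one_lt_card (α := F)
  have hdeg := FiniteField.X_pow_card_sub_X_natDegree_eq F hlt
  have hmonic : (X ^ Fintype.card F - X : F[X]).Monic :=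
    Polynomial.monic_X_pow_sub (by rw [degree_X]; exact_mod_cast hlt)
  have h := congrArg (aeval x) (prod_multiset_X_sub_C_of_monic_of_roots_card_eq hmonic (by
    rw [FiniteField.roots_X_pow_card_sub_X, hdeg]
    rfl))
  rw [FiniteField.roots_X_pow_card_sub_X] at h
  change aeval x (∏ a : F, (X - C a)) = _ at h
  simp only [map_prod, map_sub, aeval_X, map_pow, aeval_C, hx, sub_self,
    Finset.prod_eq_zero_iff, Finset.mem_univ, true_and] at h
  obtain ⟨a, ha⟩ := h
  exact ⟨a, (sub_eq_zero.1 ha).symm⟩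

theorem exists_map_eq_of_map_frobenius {f : K[X]}
    (hf : f.map (FiniteField.frobeniusAlgHom F K : K →+* K) = f) :
    ∃ g : F[X], g.map (algebraMap F K) = f := by
  rw [← mem_lifts, lifts_iff_coeff_lifts]
  intro n
  apply mem_range_algebraMap_of_pow_card
  conv_rhs => rw [← hf]
  simp [coeff_map]

theorem image_eq_of_mapsTo [Finite Z] {σ : Z → Z} (hσ : Function.Injective σ) {S : Set Z}
    (h : ∀ z ∈ S, σ z ∈ S) : σ '' S = S :=
  Set.eq_of_subset_of_ncard_le (Set.image_subset_iff.2 h)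
    (Set.ncard_image_of_injective S hσ).ge (Set.toFinite _)

/-- Frobenius is injective, so it permutes the finite stable set `S` and fixes the coefficients of
its polynomial. -/
theorem exists_map_eq_rootPoly [Finite Z] {E : Z → K} (hE : Function.Injective E) {σ : Z → Z}
    (hσ : ∀ z, E (σ z) = E z ^ Fintype.card F) {S : Set Z} (h : ∀ z ∈ S, σ z ∈ S) :
    ∃ g : F[X], g.map (algebraMap F K) = rootPoly E S := by
  apply exists_map_eq_of_map_frobenius
  have hinj : Function.Injective σ := by
    intro z w hzw
    apply hE
    apply (FiniteField.frobeniusAlgHom F K : K →+* K).injective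
    simpa [hσ] using congrArg E hzw
  conv_rhs => rw [← image_eq_of_mapsTo hinj h, rootPoly_image hinj]
  rw [rootPoly_eq_prod, rootPoly_eq_prod, Polynomial.map_prod]
  refine Finset.prod_congr rfl fun z _ => ?_
  simp [hσ]

theorem aeval_pow_card (g : F[X]) (x : K) :
    aeval (x ^ Fintype.card F) g = aeval x g ^ Fintype.card F :=
  aeval_algHom_apply (FiniteField.frobeniusAlgHom F K) x g

end Descent

/-! ### LCD codes as stable sets of roots -/

section RootData

/-- A parametrization of the roots of `X ^ N + 1` in `K` with the action of the Frobenius map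
and of the inversion on the parameters. -/
structure RootData (F K : Type*) [Field F] [Fintype F] [Field K] [Algebra F K] (N P : ℕ)
    (Z : Type*) where
  /-- the roots -/
  E : Z → K
  /-- the Frobenius map -/
  σ : Z → Z
  /-- the inversion -/
  τ : Z → Z
  inj : Function.Injective E
  E_frob : ∀ z, E (σ z) = E z ^ Fintype.card F
  E_inv : ∀ z, E (τ z) = (E z)⁻¹
  N_pos : 0 < N
  P_pos : 0 < P
  factor : (X ^ N - C (-1) : K[X]) = rootPoly E Set.univ ^ P

variable {F K Z : Type*} [Field F] [Fintype F] [Field K] [Algebra F K] [Finite Z] {N P : ℕ}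

/-- A set of parameters that is stable under Frobenius and inversion. -/
def RootData.Stable (D : RootData F K N P Z) (S : Set Z) : Prop :=
  ∀ z ∈ S, D.σ z ∈ S ∧ D.τ z ∈ S

theorem RootData.E_ne_zero (D : RootData F K N P Z) (z : Z) : D.E z ≠ 0 := by
  intro h
  have := congrArg (eval 0) D.factor
  rw [eval_pow, (eval_rootPoly_eq_zero_iff _ _).2 ⟨z, Set.mem_univ z, h.symm⟩,
    zero_pow D.P_pos.ne'] at this
  simp [D.N_pos.ne'] at this

omit [Fintype F] in
theorem aeval_inv_reverse_eq_zero_iff (f : F[X]) {x : K} (hx : x ≠ 0) :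
    aeval x⁻¹ f.reverse = 0 ↔ aeval x f = 0 := by
  let _ := invertibleOfNonzero hx
  have := eval₂_reverse_eq_zero_iff (algebraMap F K) x f
  rwa [invOf_eq_inv] at this

/-- The check polynomial has its roots outside `S`. A common root of the generator and the
reciprocal check polynomial would lie in `S` while its inverse lies outside, against stability. -/
theorem RootData.exists_code (D : RootData F K N P Z) {S : Set Z} (hS : D.Stable S) :
    ∃ Γ : Submodule F (Fin N → F),
      IsNegacyclic Γ ∧ IsLCD Γ ∧ HasGeneratorPolynomial Γ (rootPoly D.E S ^ P) := by
  obtain ⟨g₀, hg₀⟩ := exists_map_eq_rootPoly D.inj D.E_frob fun z hz => (hS z hz).1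
  have hmap : (g₀ ^ P).map (algebraMap F K) = rootPoly D.E S ^ P := by
    rw [Polynomial.map_pow, hg₀]
  have hmonic : (g₀ ^ P).Monic := by
    apply Monic.pow
    rw [← Polynomial.monic_map_iff (f := algebraMap F K), hg₀]
    exact monic_rootPoly _ _
  have hW : (X ^ N - C (-1 : F)).map (algebraMap F K) = rootPoly D.E Set.univ ^ P := by
    rw [← D.factor]
    simp
  have hdvd : g₀ ^ P ∣ X ^ N - C (-1 : F) := by
    rw [← map_dvd_map' (algebraMap F K), hmap, hW]
    exact pow_dvd_pow_of_dvd ⟨_, (rootPoly_mul_compl _ _).symm⟩ _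
  refine ⟨generatedCode N (-1) (g₀ ^ P), isConstacyclic_generatedCode D.N_pos hdvd, ?_,
    g₀ ^ P, hmap, hmonic, hdvd, rfl⟩
  obtain ⟨h, hgh⟩ := hdvd
  rw [isLCD_generatedCode_iff D.N_pos (neg_ne_zero.2 one_ne_zero) hgh.symm,
    ← isCoprime_map (algebraMap F K), hmap]
  apply IsCoprime.pow_left
  apply isCoprime_rootPoly
  intro z hz h0
  have hH : h.map (algebraMap F K) = rootPoly D.E Sᶜ ^ P := by
    have h1 := congrArg (Polynomial.map (algebraMap F K)) hgh
    rw [hW, Polynomial.map_mul, hmap, ← rootPoly_mul_compl D.E S, mul_pow] at h1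
    exact (mul_left_cancel₀ (pow_ne_zero _ (monic_rootPoly _ _).ne_zero) h1).symm
  rw [eval_map_algebraMap, ← inv_inv (D.E z),
    aeval_inv_reverse_eq_zero_iff _ (inv_ne_zero (D.E_ne_zero z)), ← D.E_inv,
    ← eval_map_algebraMap, hH, eval_pow] at h0
  exact (eval_rootPoly_eq_zero_iff_mem D.inj _ _).1 (eq_zero_of_pow_eq_zero h0) (hS z hz).2

/-- `S` is the set of roots of the generator `g`. Coprimality to the reciprocal of `h` makes `S`
closed under inversion and disjoint from the roots of `h`, which forces full multiplicities. -/
theorem RootData.exists_stable (D : RootData F K N P Z) {Γ : Submodule F (Fin N → F)}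
    (hΓ : IsNegacyclic Γ) (hL : IsLCD Γ) :
    ∃ S, D.Stable S ∧ HasGeneratorPolynomial Γ (rootPoly D.E S ^ P) := by
  obtain ⟨g, hmonic, hdvd, rfl⟩ := exists_generator D.N_pos hΓ
  obtain ⟨h, hgh⟩ := id hdvd
  rw [isLCD_generatedCode_iff D.N_pos (neg_ne_zero.2 one_ne_zero) hgh.symm] at hL
  have hcop := hL
  rw [← isCoprime_map (algebraMap F K)] at hL
  have hW : (X ^ N - C (-1 : F)).map (algebraMap F K) = rootPoly D.E Set.univ ^ P := by
    rw [← D.factor]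
    simp
  have hGH : g.map (algebraMap F K) * h.map (algebraMap F K) = rootPoly D.E Set.univ ^ P := by
    rw [← Polynomial.map_mul, ← hgh, hW]
  have hhm : h.Monic := by
    have := monic_X_pow_sub D.N_pos (-1 : F)
    rw [hgh] at this
    exact hmonic.of_mul_monic_left this
  -- a root lies on `g` or on `h`, and by coprimality on exactly one of them
  have hor : ∀ z, aeval (D.E z) g = 0 ∨ aeval (D.E z) h = 0 := by
    intro z
    have := congrArg (eval (D.E z)) hGH
    rw [eval_pow, (eval_rootPoly_eq_zero_iff_mem D.inj _ _).2 (Set.mem_univ z),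
      zero_pow D.P_pos.ne', eval_mul, mul_eq_zero] at this
    simpa only [eval_map_algebraMap] using this
  have hinv : ∀ z, aeval (D.E z) g = 0 → aeval (D.E (D.τ z)) h ≠ 0 := by
    intro z hz h0
    rw [← aeval_inv_reverse_eq_zero_iff _ (D.E_ne_zero _), D.E_inv, inv_inv] at h0
    obtain ⟨a, b, hab⟩ := hcop
    have := congrArg (aeval (D.E z)) hab
    simp [hz, h0] at this
  have hinvol : ∀ z, D.τ (D.τ z) = z := fun z => D.inj (by rw [D.E_inv, D.E_inv, inv_inv])
  have hgτ : ∀ z, aeval (D.E z) g = 0 → aeval (D.E (D.τ z)) g = 0 := fun z hz =>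
    (hor _).resolve_right (hinv z hz)
  have hnot : ∀ z, aeval (D.E z) g = 0 → aeval (D.E z) h ≠ 0 := by
    intro z hz
    have := hinv _ (hgτ z hz)
    rwa [hinvol] at this
  set S : Set Z := {z | aeval (D.E z) g = 0} with hSdef
  have hsub : ∀ z, (X - C (D.E z)) ^ P ∣ g.map (algebraMap F K) * h.map (algebraMap F K) := by
    intro z
    rw [hGH]
    refine pow_dvd_pow_of_dvd ?_ P
    rw [dvd_iff_isRoot]
    exact (eval_rootPoly_eq_zero_iff_mem D.inj _ _).2 (Set.mem_univ z)
  obtain ⟨u, hu⟩ : rootPoly D.E S ^ P ∣ g.map (algebraMap F K) := by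
    refine rootPoly_pow_dvd D.inj fun z hz => ?_
    refine IsCoprime.dvd_of_dvd_mul_right (IsCoprime.pow_left (isCoprime_X_sub_C ?_)) (hsub z)
    rw [eval_map_algebraMap]
    exact hnot z hz
  obtain ⟨v, hv⟩ : rootPoly D.E Sᶜ ^ P ∣ h.map (algebraMap F K) := by
    refine rootPoly_pow_dvd D.inj fun z hz => ?_
    refine IsCoprime.dvd_of_dvd_mul_left (IsCoprime.pow_left (isCoprime_X_sub_C ?_)) (hsub z)
    rw [eval_map_algebraMap]
    exact hz
  -- The full powers over `S` and over its complement already exhaust `X ^ N + 1`, so the cofactors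
  -- `u` and `v` are units.
  have huv : u * v = 1 := by
    have h1 := hGH
    rw [hu, hv, ← rootPoly_mul_compl D.E S, mul_pow, mul_mul_mul_comm] at h1
    exact mul_left_cancel₀ (mul_ne_zero (pow_ne_zero _ (monic_rootPoly _ _).ne_zero)
      (pow_ne_zero _ (monic_rootPoly _ _).ne_zero)) (h1.trans (mul_one _).symm)
  have hu1 : u = 1 := by
    have hum : u.Monic := by
      refine ((monic_rootPoly D.E S).pow P).of_mul_monic_left ?_
      rw [← hu]
      exact hmonic.map _
    exact hum.eq_one_of_isUnit (IsUnit.of_mul_eq_one v huv)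
  rw [hu1, mul_one] at hu
  refine ⟨S, fun z hz => ⟨?_, hgτ z hz⟩, g, hu, hmonic, hdvd, rfl⟩
  change aeval _ g = 0
  rw [D.E_frob, aeval_pow_card, show aeval (D.E z) g = 0 from hz,
    zero_pow Fintype.card_pos.ne']

omit [Fintype F] in
theorem HasGeneratorPolynomial.code_unique {Γ Γ' : Submodule F (Fin N → F)} {G : K[X]}
    (h : HasGeneratorPolynomial Γ G) (h' : HasGeneratorPolynomial Γ' G) : Γ = Γ' := by
  obtain ⟨g, hg, -, -, rfl⟩ := h
  obtain ⟨g', hg', -, -, rfl⟩ := h'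
  rw [map_injective _ (algebraMap F K).injective (hg.trans hg'.symm)]

omit [Fintype F] in
theorem HasGeneratorPolynomial.poly_unique (hN : 0 < N) {Γ : Submodule F (Fin N → F)}
    {G G' : K[X]} (h : HasGeneratorPolynomial Γ G) (h' : HasGeneratorPolynomial Γ G') :
    G = G' := by
  obtain ⟨g, rfl, hm, hd, rfl⟩ := h
  obtain ⟨g', rfl, hm', hd', h'⟩ := h'
  rw [generatedCode_injective hN hd hm hd' hm' h']

theorem RootData.rootPoly_pow_injective (D : RootData F K N P Z) :
    Function.Injective fun S => rootPoly D.E S ^ P := by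
  intro S T h
  ext z
  rw [← eval_rootPoly_eq_zero_iff_mem D.inj, ← eval_rootPoly_eq_zero_iff_mem D.inj,
    ← pow_eq_zero_iff D.P_pos.ne', ← pow_eq_zero_iff (a := eval _ (rootPoly _ T)) D.P_pos.ne',
    ← eval_pow, ← eval_pow]
  exact (congrArg (fun p => eval (D.E z) p = 0) h).to_iff

theorem RootData.numLCDNegacyclic_eq (D : RootData F K N P Z) :
    numLCDNegacyclic F N = {S | D.Stable S}.ncard := by
  symm
  refine Set.ncard_congr (fun S hS => (D.exists_code hS).choose) ?_ ?_ ?_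
  · intro S hS
    have := (D.exists_code hS).choose_spec
    exact ⟨this.1, this.2.1⟩
  · intro S T hS hT h
    have h1 := (D.exists_code hS).choose_spec.2.2
    have h2 := (D.exists_code hT).choose_spec.2.2
    rw [h] at h1
    exact D.rootPoly_pow_injective (h1.poly_unique D.N_pos h2)
  · rintro Γ ⟨h1, h2⟩
    obtain ⟨S, hS, h⟩ := D.exists_stable h1 h2
    exact ⟨S, hS, ((D.exists_code hS).choose_spec.2.2).code_unique h⟩

end RootData

end NegacyclicLCD

namespace NegacyclicLCD

/-! ### Counting and listing by orbits -/

section Blocks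

variable {F K Z : Type*} [Field F] [Fintype F] [Field K] [Algebra F K] {N P : ℕ}

/-- A partition of the parameters into orbits of Frobenius and inversion. -/
structure RootData.IsOrbitPartition (D : RootData F K N P Z) {ι : Type*} (B : ι → Set Z) :
    Prop where
  partition : ∀ z, ∃! k, z ∈ B k
  nonempty : ∀ k, (B k).Nonempty
  stable : ∀ k, D.Stable (B k)
  minimal : ∀ k S, D.Stable S → ∀ z ∈ B k, z ∈ S → B k ⊆ S

variable {D : RootData F K N P Z} {ι : Type*} {B : ι → Set Z}

theorem RootData.IsOrbitPartition.disjoint (h : D.IsOrbitPartition B) :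
    Pairwise (Function.onFun Disjoint B) := by
  intro i j hij
  rw [Function.onFun, Set.disjoint_left]
  exact fun z hi hj => hij ((h.partition z).unique hi hj)

theorem RootData.IsOrbitPartition.stable_iUnion (h : D.IsOrbitPartition B) (T : Set ι) :
    D.Stable (⋃ k ∈ T, B k) := by
  intro z hz
  simp only [Set.mem_iUnion] at hz ⊢
  obtain ⟨k, hk, hz⟩ := hz
  exact ⟨⟨k, hk, (h.stable k z hz).1⟩, ⟨k, hk, (h.stable k z hz).2⟩⟩

/-- By minimality, a stable set contains every block that it meets. -/
theorem RootData.IsOrbitPartition.eq_iUnion (h : D.IsOrbitPartition B) {S : Set Z}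
    (hS : D.Stable S) : ⋃ k ∈ {k | B k ⊆ S}, B k = S := by
  ext z
  simp only [Set.mem_iUnion]
  constructor
  · rintro ⟨k, hk, hz⟩
    exact hk hz
  · intro hz
    obtain ⟨k, hk, -⟩ := h.partition z
    exact ⟨k, h.minimal k S hS z hk hz, hk⟩

theorem RootData.IsOrbitPartition.iUnion_injective (h : D.IsOrbitPartition B) :
    Function.Injective fun T : Set ι => ⋃ k ∈ T, B k := by
  intro T T' hT
  ext k
  obtain ⟨z, hz⟩ := h.nonempty k
  have key : ∀ T : Set ι, z ∈ (⋃ k ∈ T, B k) ↔ k ∈ T := by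
    intro T
    simp only [Set.mem_iUnion]
    constructor
    · rintro ⟨j, hj, hzj⟩
      rwa [(h.partition z).unique hz hzj]
    · exact fun hk => ⟨k, hk, hz⟩
  rw [← key T, ← key T']
  exact (congrArg (z ∈ ·) hT).to_iff

variable [Finite Z] [Fintype ι]

theorem RootData.IsOrbitPartition.numLCDNegacyclic_eq (h : D.IsOrbitPartition B) :
    numLCDNegacyclic F N = 2 ^ Fintype.card ι := by
  have : {S | D.Stable S} = Set.range fun T : Set ι => ⋃ k ∈ T, B k := by
    ext S
    constructor
    · exact fun hS => ⟨_, h.eq_iUnion hS⟩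
    · rintro ⟨T, rfl⟩
      exact h.stable_iUnion T
  rw [D.numLCDNegacyclic_eq, this, ← Set.image_univ,
    Set.ncard_image_of_injective _ h.iUnion_injective, Set.ncard_univ, Nat.card_eq_fintype_card,
    Fintype.card_set]

theorem RootData.IsOrbitPartition.rootPoly_iUnion (h : D.IsOrbitPartition B) (T : Set ι)
    {ε : ι → ℕ} (hT : ∀ k ∈ T, ε k = P) (hT' : ∀ k ∉ T, ε k = 0) :
    rootPoly D.E (⋃ k ∈ T, B k) ^ P = ∏ k, rootPoly D.E (B k) ^ ε k := by
  classical
  rw [rootPoly, finprod_mem_biUnion (fun i _ j _ hij => h.disjoint hij) (Set.toFinite _)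
    (fun _ _ => Set.toFinite _), finprod_mem_eq_finite_toFinset_prod _ (Set.toFinite T),
    ← Finset.prod_pow]
  symm
  refine (Finset.prod_subset (Finset.subset_univ _) ?_).symm.trans
    (Finset.prod_congr rfl fun k hk => ?_)
  · intro k _ hk
    rw [hT' k (by simpa using hk), pow_zero]
  · rw [hT k (by simpa using hk)]
    rfl

theorem RootData.IsOrbitPartition.generates (h : D.IsOrbitPartition B) :
    GeneratesLCDNegacyclic F N {G : K[X] | ∃ ε : ι → ℕ, (∀ k, ε k = 0 ∨ ε k = P) ∧
      G = ∏ k, rootPoly D.E (B k) ^ ε k} := by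
  constructor
  · rintro G ⟨ε, hε, rfl⟩
    rw [← h.rootPoly_iUnion {k | ε k = P} (fun k hk => hk) fun k hk => (hε k).resolve_right hk]
    exact D.exists_code (h.stable_iUnion _)
  · intro Γ h1 h2
    classical
    obtain ⟨S, hS, hG⟩ := D.exists_stable h1 h2
    refine ⟨_, ⟨fun k => if B k ⊆ S then P else 0, fun k => ?_, ?_⟩, hG⟩
    · dsimp only
      split_ifs <;> simp
    · conv_lhs => rw [← h.eq_iUnion hS]
      exact h.rootPoly_iUnion _ (fun k hk => if_pos hk) fun k hk => if_neg hk

end Blocks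

end NegacyclicLCD

namespace NegacyclicLCD

/-! ### Cyclotomic cosets -/

section CosetBasics

variable {q M : ℕ}

theorem mem_cyclotomicCoset_self (t : ZMod M) : t ∈ cyclotomicCoset q t := ⟨0, by simp⟩

theorem mem_cyclotomicCoset_trans {a b c : ZMod M} (h : a ∈ cyclotomicCoset q b)
    (h' : b ∈ cyclotomicCoset q c) : a ∈ cyclotomicCoset q c := by
  obtain ⟨i, rfl⟩ := h
  obtain ⟨j, rfl⟩ := h'
  exact ⟨j + i, by rw [pow_add, mul_assoc]⟩

theorem mul_mem_cyclotomicCoset {a b : ZMod M} (h : a ∈ cyclotomicCoset q b) :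
    (q : ZMod M) * a ∈ cyclotomicCoset q b := by
  obtain ⟨i, rfl⟩ := h
  exact ⟨i + 1, by ring⟩

theorem neg_mem_cyclotomicCoset {a b : ZMod M} (h : a ∈ cyclotomicCoset q b) :
    -a ∈ cyclotomicCoset q (-b) := by
  obtain ⟨i, rfl⟩ := h
  exact ⟨i, by ring⟩

theorem mem_cyclotomicCoset_zero {a : ZMod M} : a ∈ cyclotomicCoset q 0 ↔ a = 0 := by
  simp [cyclotomicCoset]

theorem exists_pow_mul_eq_one [NeZero M] (hq : q.Coprime M) (j : ℕ) :
    ∃ i, (q : ZMod M) ^ (j + i) = 1 := by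
  have hu : IsUnit (q : ZMod M) := (ZMod.isUnit_iff_coprime q M).2 hq
  obtain ⟨u, hu⟩ := hu
  have hpos : 0 < orderOf u := orderOf_pos u
  refine ⟨j * (orderOf u - 1), ?_⟩
  rw [← hu, ← Units.val_pow_eq_pow_val,
    show j + j * (orderOf u - 1) = orderOf u * j by
      obtain ⟨k, hk⟩ := Nat.exists_eq_succ_of_ne_zero hpos.ne'
      rw [hk, Nat.succ_eq_add_one, Nat.add_sub_cancel]
      ring, pow_mul, pow_orderOf_eq_one]
  simp

theorem mem_cyclotomicCoset_symm [NeZero M] (hq : q.Coprime M) {a b : ZMod M}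
    (h : a ∈ cyclotomicCoset q b) : b ∈ cyclotomicCoset q a := by
  obtain ⟨j, rfl⟩ := h
  obtain ⟨i, hi⟩ := exists_pow_mul_eq_one hq j
  exact ⟨i, by rw [mul_assoc, ← pow_add, hi, mul_one]⟩

end CosetBasics

/-! ### The order of `q` modulo powers of `l` -/

section Order

variable {q l : ℕ}

theorem natCast_pow_eq_one_iff (hq : 0 < q) (M k : ℕ) :
    (q : ZMod M) ^ k = 1 ↔ M ∣ q ^ k - 1 := by
  rw [← ZMod.natCast_eq_zero_iff, Nat.cast_sub (Nat.one_le_pow _ _ hq), sub_eq_zero]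
  simp

theorem ordMod_pos (hl : l.Prime) (hql : q.Coprime l) : 0 < ordMod q l := by
  have : Fact l.Prime := ⟨hl⟩
  obtain ⟨i, hi⟩ := exists_pow_mul_eq_one hql 1
  exact orderOf_pos_iff.2 (isOfFinOrder_iff_pow_eq_one.2 ⟨1 + i, by omega, hi⟩)

/-- Lifting the exponent: `l ∣ q ^ k - 1` only for `k` a multiple of `f`, and `q ^ (f * k) - 1` has
`l`-adic valuation `s` plus that of `k`. So `λ(r)` is the order of `q` modulo `l ^ r`. -/
theorem pow_eq_one_iff_lambdaOrd_dvd (hl : l.Prime) (hl2 : Odd l) (hq1 : 1 < q)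
    (hql : q.Coprime l) {r : ℕ} (hr : 0 < r) (k : ℕ) :
    (q : ZMod (l ^ r)) ^ k = 1 ↔ lambdaOrd q l r ∣ k := by
  have : Fact l.Prime := ⟨hl⟩
  have hf := ordMod_pos hl hql
  have hdiv : ∀ k, l ∣ q ^ k - 1 ↔ ordMod q l ∣ k := fun k => by
    rw [← natCast_pow_eq_one_iff (by omega), ordMod, orderOf_dvd_iff_pow_eq_one]
  rw [natCast_pow_eq_one_iff (by omega)]
  by_cases hk : ordMod q l ∣ k
  · obtain ⟨k, rfl⟩ := hk
    rw [lambdaOrd, Nat.mul_dvd_mul_iff_left hf]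
    rcases Nat.eq_zero_or_pos k with rfl | hkpos
    · simp
    have hlt : 1 < q ^ ordMod q l := Nat.one_lt_pow hf.ne' hq1
    have hlte := padicValNat.pow_sub_pow (p := l) (x := q ^ ordMod q l) (y := 1) hl2 hlt
      ((hdiv _).2 dvd_rfl) (fun h => by
        have h1 := hl.dvd_of_dvd_pow h
        exact hl.one_lt.ne' (Nat.dvd_one.1 (hql ▸ Nat.dvd_gcd h1 dvd_rfl))) hkpos.ne'
    rw [one_pow, ← pow_mul] at hlte
    have hne : q ^ (ordMod q l * k) - 1 ≠ 0 := by
      have : 1 < q ^ (ordMod q l * k) := Nat.one_lt_pow (mul_pos hf hkpos).ne' hq1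
      omega
    rw [padicValNat_dvd_iff_le hne, padicValNat_dvd_iff_le hkpos.ne', hlte]
    omega
  · refine iff_of_false (fun h => hk ((hdiv k).1 ((dvd_pow_self l hr.ne').trans h))) fun h => hk ?_
    exact (Dvd.intro _ rfl).trans h

theorem odd_lambdaOrd (hl2 : Odd l) (h : Odd (ordMod q l)) (r : ℕ) : Odd (lambdaOrd q l r) :=
  h.mul hl2.pow

/-- An odd prime divides at most one of `x - 1` and `x + 1`, so the other is a unit. -/
theorem eq_one_or_neg_one_of_sq (hl : l.Prime) (hl2 : Odd l) {m : ℕ} {x : ZMod (l ^ m)}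
    (hx : x ^ 2 = 1) : x = 1 ∨ x = -1 := by
  obtain ⟨x, rfl⟩ := ZMod.intCast_surjective x
  have hpl : Prime (l : ℤ) := Nat.prime_iff_prime_int.1 hl
  have h : ((l ^ m : ℕ) : ℤ) ∣ (x - 1) * (x + 1) := by
    rw [← ZMod.intCast_zmod_eq_zero_iff_dvd]
    push_cast
    linear_combination hx
  push_cast at h
  have conv1 : ((l : ℤ) ^ m ∣ x - 1) → (x : ZMod (l ^ m)) = 1 := by
    intro h
    have := (ZMod.intCast_zmod_eq_zero_iff_dvd (x - 1) (l ^ m)).2 (by exact_mod_cast h)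
    push_cast at this
    exact sub_eq_zero.1 this
  have conv2 : ((l : ℤ) ^ m ∣ x + 1) → (x : ZMod (l ^ m)) = -1 := by
    intro h
    have := (ZMod.intCast_zmod_eq_zero_iff_dvd (x + 1) (l ^ m)).2 (by exact_mod_cast h)
    push_cast at this
    exact eq_neg_of_add_eq_zero_left this
  by_cases hd : (l : ℤ) ∣ x - 1
  · have hd' : ¬ (l : ℤ) ∣ x + 1 := by
      intro h'
      have h2 : (l : ℤ) ∣ 2 := by
        have := dvd_sub h' hd
        ring_nf at this
        exact this
      have h3 : l ∣ 2 := by exact_mod_cast h2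
      rw [Nat.prime_dvd_prime_iff_eq hl Nat.prime_two] at h3
      subst h3
      exact absurd hl2 (by decide)
    exact Or.inl (conv1 (((hpl.coprime_iff_not_dvd.2 hd').pow_left).dvd_of_dvd_mul_right h))
  · exact Or.inr (conv2 (((hpl.coprime_iff_not_dvd.2 hd).pow_left).dvd_of_dvd_mul_left h))

theorem one_ne_neg_one (hl : l.Prime) (hl2 : Odd l) {r : ℕ} (hr : 0 < r) :
    (1 : ZMod (l ^ r)) ≠ -1 := by
  intro h
  have h2 : ((2 : ℕ) : ZMod (l ^ r)) = 0 := by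
    push_cast
    linear_combination h
  rw [ZMod.natCast_eq_zero_iff] at h2
  have h3 := (dvd_pow_self l hr.ne').trans h2
  rw [Nat.prime_dvd_prime_iff_eq hl Nat.prime_two] at h3
  subst h3
  exact absurd hl2 (by decide)

/-- The exponent is half the order `λ(m)`, so the power is a square root of 1 other than 1. As `l`
is odd, the exponent has the parity of `f / 2`; this is what separates `f ≡ 2` from `f ≡ 0` modulo
4. -/
theorem pow_half_lambdaOrd (hl : l.Prime) (hl2 : Odd l) (hq1 : 1 < q) (hql : q.Coprime l)
    {m : ℕ} (hm : 0 < m) (hf : Even (ordMod q l)) :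
    (q : ZMod (l ^ m)) ^ (ordMod q l / 2 * l ^ (m - padicValNat l (q ^ ordMod q l - 1))) = -1 := by
  have hpos := ordMod_pos hl hql
  obtain ⟨c, hc⟩ := hf
  have hlam : lambdaOrd q l m =
      (ordMod q l / 2 * l ^ (m - padicValNat l (q ^ ordMod q l - 1))) * 2 := by
    rw [lambdaOrd, mul_right_comm]
    congr 1
    omega
  set d := ordMod q l / 2 * l ^ (m - padicValNat l (q ^ ordMod q l - 1)) with hd
  have hd0 : 0 < d := mul_pos (by omega) (pow_pos hl.pos _)
  have hsq : ((q : ZMod (l ^ m)) ^ d) ^ 2 = 1 := by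
    rw [← pow_mul, pow_eq_one_iff_lambdaOrd_dvd hl hl2 hq1 hql hm, hlam]
  refine (eq_one_or_neg_one_of_sq hl hl2 hsq).resolve_left fun h => ?_
  rw [pow_eq_one_iff_lambdaOrd_dvd hl hl2 hq1 hql hm, hlam] at h
  have := Nat.le_of_dvd hd0 h
  omega

end Order

/-! ### Coset representatives, level by level -/

section Levels

variable {q l m : ℕ}

/-- Multiplication by `l ^ (m - r)` kills exactly the multiples of `l ^ r`. Questions about the
level of elements `l ^ (m - r) * unit` thus become questions modulo `l ^ r`. -/
theorem pow_mul_eq_pow_mul_iff (hl : l.Prime) {r : ℕ} (hr : r ≤ m) (a b : ZMod (l ^ m)) :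
    (l : ZMod (l ^ m)) ^ (m - r) * a = (l : ZMod (l ^ m)) ^ (m - r) * b ↔
      ZMod.castHom (pow_dvd_pow l hr) (ZMod (l ^ r)) a =
        ZMod.castHom (pow_dvd_pow l hr) (ZMod (l ^ r)) b := by
  obtain ⟨a, rfl⟩ := ZMod.intCast_surjective a
  obtain ⟨b, rfl⟩ := ZMod.intCast_surjective b
  rw [map_intCast, map_intCast, ← sub_eq_zero, ← mul_sub, ← sub_eq_zero (a := (a : ZMod (l ^ r))),
    ← Int.cast_sub, ← Int.cast_sub, ZMod.intCast_zmod_eq_zero_iff_dvd,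
    show (l : ZMod (l ^ m)) ^ (m - r) * ((a - b : ℤ) : ZMod (l ^ m)) =
      (((l : ℤ) ^ (m - r) * (a - b) : ℤ) : ZMod (l ^ m)) by push_cast; rfl,
    ZMod.intCast_zmod_eq_zero_iff_dvd]
  push_cast
  conv_lhs => rw [← Nat.sub_add_cancel hr, Nat.add_sub_cancel, pow_add]
  exact mul_dvd_mul_iff_left (pow_ne_zero _ (by exact_mod_cast hl.ne_zero))

theorem exists_eq_pow_mul_unit (hl : l.Prime) {t : ZMod (l ^ m)} (ht : t ≠ 0) :
    ∃ r, 0 < r ∧ r ≤ m ∧ ∃ u : (ZMod (l ^ m))ˣ,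
      t = (l : ZMod (l ^ m)) ^ (m - r) * (u : ZMod (l ^ m)) := by
  have : NeZero (l ^ m) := ⟨pow_ne_zero _ hl.ne_zero⟩
  have hv : t.val ≠ 0 := by rwa [Ne, ZMod.val_eq_zero]
  obtain ⟨a, u, hu, hau⟩ := Nat.exists_eq_pow_mul_and_not_dvd hv l hl.ne_one
  have ha : a < m := by
    by_contra h
    have h1 : l ^ m ∣ t.val := (pow_dvd_pow l (not_lt.1 h)).trans (hau ▸ Dvd.intro _ rfl)
    exact (Nat.le_of_dvd (Nat.pos_of_ne_zero hv) h1).not_gt (ZMod.val_lt t)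
  refine ⟨m - a, by omega, by omega, ZMod.unitOfCoprime u
    (Nat.Coprime.pow_right _ (((Nat.Prime.coprime_iff_not_dvd hl).2 hu).symm)), ?_⟩
  rw [ZMod.coe_unitOfCoprime, show m - (m - a) = a by omega]
  conv_lhs => rw [← ZMod.natCast_zmod_val t, hau]
  push_cast
  rfl

theorem pow_mul_unit_ne_zero (hl : l.Prime) {r : ℕ} (hr : 0 < r) (hrm : r ≤ m)
    (u : (ZMod (l ^ m))ˣ) : (l : ZMod (l ^ m)) ^ (m - r) * (u : ZMod (l ^ m)) ≠ 0 := by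
  intro h
  have : Fact (1 < l ^ r) := ⟨Nat.one_lt_pow hr.ne' hl.one_lt⟩
  rw [← mul_zero ((l : ZMod (l ^ m)) ^ (m - r)), pow_mul_eq_pow_mul_iff hl hrm, map_zero] at h
  exact (u.isUnit.map (ZMod.castHom (pow_dvd_pow l hrm) (ZMod (l ^ r)))).ne_zero h

theorem level_le_of_eq (hl : l.Prime) {r r' : ℕ} (hrm : r ≤ m) (hrm' : r' ≤ m)
    {u u' : (ZMod (l ^ m))ˣ}
    (h : (l : ZMod (l ^ m)) ^ (m - r) * (u : ZMod (l ^ m)) =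
      (l : ZMod (l ^ m)) ^ (m - r') * (u' : ZMod (l ^ m))) : r ≤ r' := by
  by_contra hlt
  have hz : (l : ZMod (l ^ m)) ^ m = 0 := by
    have := ZMod.natCast_self (l ^ m)
    push_cast at this
    exact this
  -- If `r' < r`, multiplication by `l ^ r'` kills the right-hand side but not the left.
  have h1 := congrArg ((l : ZMod (l ^ m)) ^ r' * ·) h
  simp only [← mul_assoc, ← pow_add] at h1
  rw [show r' + (m - r') = m by omega, hz, zero_mul, show r' + (m - r) = m - (r - r') by omega] at h1
  exact pow_mul_unit_ne_zero hl (by omega) (by omega) u h1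

theorem level_unique (hl : l.Prime) {r r' : ℕ} (hrm : r ≤ m)
    (hrm' : r' ≤ m) {u u' : (ZMod (l ^ m))ˣ}
    (h : (l : ZMod (l ^ m)) ^ (m - r) * (u : ZMod (l ^ m)) ∈
      cyclotomicCoset q ((l : ZMod (l ^ m)) ^ (m - r') * (u' : ZMod (l ^ m))))
    (hq : q.Coprime l) : r = r' := by
  obtain ⟨j, h⟩ := h
  rw [mul_assoc] at h
  have hc : (q : ZMod (l ^ m)) = (ZMod.unitOfCoprime q (hq.pow_right m) : (ZMod (l ^ m))ˣ) := by
    rw [ZMod.coe_unitOfCoprime]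
  rw [hc, ← Units.val_pow_eq_pow_val, ← Units.val_mul] at h
  exact le_antisymm (level_le_of_eq hl hrm hrm' h) (level_le_of_eq hl hrm' hrm h.symm)

/-- Used for even `f`: only even powers of `q` fix a nonzero `t`, so its coset splits into two
`q²`-cosets. -/
theorem ordMod_dvd_of_mul_pow_eq (hl : l.Prime) (hl2 : Odd l) (hq1 : 1 < q) (hql : q.Coprime l)
    {t : ZMod (l ^ m)} (ht : t ≠ 0) {j : ℕ} (h : t * (q : ZMod (l ^ m)) ^ j = t) :
    ordMod q l ∣ j := by
  obtain ⟨r, hr, hrm, u, rfl⟩ := exists_eq_pow_mul_unit hl ht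
  rw [mul_assoc, pow_mul_eq_pow_mul_iff hl hrm, map_mul, map_pow, map_natCast] at h
  have hu := u.isUnit.map (ZMod.castHom (pow_dvd_pow l hrm) (ZMod (l ^ r)))
  have h1 := hu.mul_left_cancel (h.trans (mul_one _).symm)
  rw [pow_eq_one_iff_lambdaOrd_dvd hl hl2 hq1 hql hr] at h1
  exact (Dvd.intro _ rfl).trans h1

/-- The units modulo `l ^ r` up to powers of `q`. -/
abbrev UnitClasses (l r : ℕ) {q : ℕ} (hq : q.Coprime l) : Type :=
  (ZMod (l ^ r))ˣ ⧸ Subgroup.zpowers (ZMod.unitOfCoprime q (hq.pow_right r))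

/-- The class of a unit modulo `l ^ m` among the units modulo `l ^ r` up to powers of `q`. -/
def unitClass {r : ℕ} (hr : r ≤ m) (hq : q.Coprime l) :
    (ZMod (l ^ m))ˣ →* UnitClasses l r hq :=
  (QuotientGroup.mk' _).comp (ZMod.unitsMap (pow_dvd_pow l hr))

theorem mem_coset_iff_unitClass (hl : l.Prime) {r : ℕ} (hr : r ≤ m) (hq : q.Coprime l)
    (a b : (ZMod (l ^ m))ˣ) :
    (l : ZMod (l ^ m)) ^ (m - r) * (a : ZMod (l ^ m)) ∈
        cyclotomicCoset q ((l : ZMod (l ^ m)) ^ (m - r) * (b : ZMod (l ^ m))) ↔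
      unitClass hr hq b = unitClass hr hq a := by
  have : NeZero (l ^ r) := ⟨pow_ne_zero _ hl.ne_zero⟩
  simp only [unitClass, MonoidHom.comp_apply, QuotientGroup.mk'_apply, QuotientGroup.eq]
  rw [← mem_powers_iff_mem_zpowers, Submonoid.mem_powers_iff]
  refine exists_congr fun j => ?_
  rw [mul_assoc, pow_mul_eq_pow_mul_iff hl hr, map_mul, map_pow, map_natCast, eq_inv_mul_iff_mul_eq,
    Units.ext_iff, eq_comm]
  simp [ZMod.unitsMap_val]

theorem deltaNum_eq_card (hl : l.Prime) (hl2 : Odd l) (hq1 : 1 < q) (hq : q.Coprime l)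
    {r : ℕ} (hr : 0 < r) : deltaNum q l r = Nat.card (UnitClasses l r hq) := by
  have : NeZero (l ^ r) := ⟨pow_ne_zero _ hl.ne_zero⟩
  have hord : orderOf (ZMod.unitOfCoprime q (hq.pow_right r)) = lambdaOrd q l r := by
    refine Nat.dvd_antisymm ?_ ?_
    · rw [orderOf_dvd_iff_pow_eq_one, Units.ext_iff, Units.val_pow_eq_pow_val,
        ZMod.coe_unitOfCoprime, Units.val_one, pow_eq_one_iff_lambdaOrd_dvd hl hl2 hq1 hq hr]
    · rw [← pow_eq_one_iff_lambdaOrd_dvd hl hl2 hq1 hq hr, ← ZMod.coe_unitOfCoprime q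
        (hq.pow_right r), ← Units.val_pow_eq_pow_val, pow_orderOf_eq_one, Units.val_one]
  rw [deltaNum, ← ZMod.card_units_eq_totient, ← hord, ← Nat.card_zpowers,
    ← Nat.card_eq_fintype_card, Subgroup.card_eq_card_quotient_mul_card_subgroup
      (Subgroup.zpowers (ZMod.unitOfCoprime q (hq.pow_right r)))]
  exact Nat.mul_div_cancel _ Nat.card_pos

variable {g : (ZMod (l ^ m))ˣ}

/-- The image of `g` generates the group of units modulo `l ^ r` up to powers of `q`, whose order is
`δ(r)` because `λ(r)` is the order of `q`. Hence the exponent of `g` labels the cosets of level `r`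
modulo `δ(r)`. -/
theorem orderOf_unitClass (hl : l.Prime) (hl2 : Odd l) (hq1 : 1 < q) (hq : q.Coprime l)
    (hg : ∀ x, x ∈ Subgroup.zpowers g) {r : ℕ} (hr : 0 < r) (hrm : r ≤ m) :
    orderOf (unitClass hrm hq g) = deltaNum q l r := by
  have : NeZero (l ^ m) := ⟨pow_ne_zero _ hl.ne_zero⟩
  rw [deltaNum_eq_card hl hl2 hq1 hq hr]
  apply orderOf_eq_card_of_forall_mem_zpowers
  intro x
  have hs : Function.Surjective (unitClass hrm hq) :=
    (QuotientGroup.mk'_surjective _).comp (ZMod.unitsMap_surjective _)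
  obtain ⟨y, rfl⟩ := hs x
  obtain ⟨k, rfl⟩ := hg y
  exact ⟨k, by simp⟩

theorem deltaNum_pos (hl : l.Prime) (hl2 : Odd l) (hq1 : 1 < q) (hq : q.Coprime l)
    {r : ℕ} (hr : 0 < r) : 0 < deltaNum q l r := by
  have : NeZero (l ^ r) := ⟨pow_ne_zero _ hl.ne_zero⟩
  rw [deltaNum_eq_card hl hl2 hq1 hq hr]
  exact Nat.card_pos

theorem pow_mem_coset_iff (hl : l.Prime) (hl2 : Odd l) (hq1 : 1 < q) (hq : q.Coprime l)
    (hg : ∀ x, x ∈ Subgroup.zpowers g) {r : ℕ} (hr : 0 < r) (hrm : r ≤ m) (i j : ℕ) :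
    (l : ZMod (l ^ m)) ^ (m - r) * (g : ZMod (l ^ m)) ^ i ∈
      cyclotomicCoset q ((l : ZMod (l ^ m)) ^ (m - r) * (g : ZMod (l ^ m)) ^ j) ↔
      j ≡ i [MOD deltaNum q l r] := by
  rw [← Units.val_pow_eq_pow_val, ← Units.val_pow_eq_pow_val, mem_coset_iff_unitClass hl hrm hq,
    map_pow, map_pow, ← orderOf_unitClass hl hl2 hq1 hq hg hr hrm]
  exact pow_eq_pow_iff_modEq (x := unitClass hrm hq g)

theorem exists_level_pow (hl : l.Prime) (hg : ∀ x, x ∈ Subgroup.zpowers g) {t : ZMod (l ^ m)}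
    (ht : t ≠ 0) : ∃ r, 0 < r ∧ r ≤ m ∧
      ∃ k : ℕ, t = (l : ZMod (l ^ m)) ^ (m - r) * (g : ZMod (l ^ m)) ^ k := by
  have : NeZero (l ^ m) := ⟨pow_ne_zero _ hl.ne_zero⟩
  obtain ⟨r, hr, hrm, u, rfl⟩ := exists_eq_pow_mul_unit hl ht
  have hu := hg u
  rw [← mem_powers_iff_mem_zpowers] at hu
  obtain ⟨k, rfl⟩ := hu
  exact ⟨r, hr, hrm, k, by simp⟩

/-- The indices of the representatives `l ^ (m - r) * g ^ k` of the nonzero cosets. -/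
abbrev CosetIndex (m : ℕ) (d : ℕ → ℕ) : Type := Σ r : Finset.Icc 1 m, Fin (d r)

/-- The representative `l ^ (m - r) * g ^ k`. -/
def cosetRep (g : (ZMod (l ^ m))ˣ) {d : ℕ → ℕ} (i : CosetIndex m d) : ZMod (l ^ m) :=
  (l : ZMod (l ^ m)) ^ (m - (i.1 : ℕ)) * (g : ZMod (l ^ m)) ^ (i.2 : ℕ)

theorem cosetRep_ne_zero (hl : l.Prime) {d : ℕ → ℕ} (i : CosetIndex m d) :
    cosetRep g i ≠ 0 := by
  have hi := Finset.mem_Icc.1 i.1.2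
  unfold cosetRep
  rw [← Units.val_pow_eq_pow_val]
  exact pow_mul_unit_ne_zero hl (by omega) (by omega) _

theorem card_cosetIndex (d : ℕ → ℕ) :
    Fintype.card (CosetIndex m d) = ∑ r ∈ Finset.Icc 1 m, d r := by
  rw [Fintype.card_sigma, ← Finset.sum_coe_sort (Finset.Icc 1 m)]
  simp only [Fintype.card_fin]

theorem existsUnique_cosetRep (hl : l.Prime) (hl2 : Odd l) (hq1 : 1 < q) (hq : q.Coprime l)
    (hg : ∀ x, x ∈ Subgroup.zpowers g) {t : ZMod (l ^ m)} (ht : t ≠ 0) :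
    ∃! i : CosetIndex m (deltaNum q l), t ∈ cyclotomicCoset q (cosetRep g i) := by
  have : NeZero (l ^ m) := ⟨pow_ne_zero _ hl.ne_zero⟩
  obtain ⟨r, hr, hrm, k, rfl⟩ := exists_level_pow hl hg ht
  refine ⟨⟨⟨r, Finset.mem_Icc.2 ⟨hr, hrm⟩⟩, ⟨k % deltaNum q l r,
    Nat.mod_lt _ (deltaNum_pos hl hl2 hq1 hq hr)⟩⟩, ?_, ?_⟩
  · exact (pow_mem_coset_iff hl hl2 hq1 hq hg hr hrm _ _).2 (Nat.mod_modEq _ _)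
  · rintro ⟨⟨r', hr'⟩, k', hk'⟩ h
    obtain ⟨h1, h2⟩ := Finset.mem_Icc.1 hr'
    simp only [cosetRep] at h hk'
    obtain rfl : r = r' := by
      rw [← Units.val_pow_eq_pow_val, ← Units.val_pow_eq_pow_val] at h
      exact level_unique hl hrm h2 h hq
    rw [pow_mem_coset_iff hl hl2 hq1 hq hg hr hrm] at h
    have : k' = k % deltaNum q l r := by
      rw [← h, Nat.mod_eq_of_lt hk']
    subst this
    rfl

theorem exists_isCosetSystem (hl : l.Prime) (hl2 : Odd l) (hq1 : 1 < q) (hq : q.Coprime l)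
    (m : ℕ) : ∃ ρ : Fin (eNum q l m + 1) → ZMod (l ^ m), IsCosetSystem q ρ := by
  have hcyc := ZMod.isCyclic_units_of_prime_pow l hl (by rintro rfl; exact absurd hl2 (by decide)) m
  obtain ⟨g, hg⟩ := hcyc.exists_generator
  let φ : CosetIndex m (deltaNum q l) ≃ Fin (eNum q l m) :=
    Fintype.equivFinOfCardEq (card_cosetIndex _)
  refine ⟨Fin.cons 0 fun k => cosetRep g (φ.symm k), rfl, fun t => ?_⟩
  by_cases ht : t = 0
  · refine ⟨0, by simpa [mem_cyclotomicCoset_zero] using ht, fun i hi => ?_⟩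
    have : NeZero (l ^ m) := ⟨pow_ne_zero _ hl.ne_zero⟩
    induction i using Fin.cases with
    | zero => rfl
    | succ k =>
      rw [Fin.cons_succ, ht] at hi
      exact absurd (mem_cyclotomicCoset_zero.1 (mem_cyclotomicCoset_symm (hq.pow_right m) hi))
        (cosetRep_ne_zero hl _)
  · obtain ⟨i, hi, huniq⟩ := existsUnique_cosetRep hl hl2 hq1 hq hg ht
    refine ⟨(φ i).succ, by simpa using hi, fun j hj => ?_⟩
    induction j using Fin.cases with
    | zero => exact absurd (mem_cyclotomicCoset_zero.1 hj) ht
    | succ k =>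
      rw [Fin.cons_succ] at hj
      rw [← huniq _ hj, Equiv.apply_symm_apply]

end Levels

/-! ### Negation of cosets when `f` is odd -/

section OddOrder

variable {q l m : ℕ} {g : (ZMod (l ^ m))ˣ}

/-- As `q` has odd order, `-1` is not a power of `q`. Its class therefore has order two in a cyclic
group of order `δ(r)`, and must be the class of `g ^ (δ(r) / 2)`. -/
theorem exists_neg_eq (hl : l.Prime) (hl2 : Odd l) (hq1 : 1 < q) (hq : q.Coprime l)
    (hg : ∀ x, x ∈ Subgroup.zpowers g) (hf : Odd (ordMod q l)) {r : ℕ} (hr : 0 < r)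
    (hrm : r ≤ m) : Even (deltaNum q l r) ∧ ∀ k : ℕ,
      -((l : ZMod (l ^ m)) ^ (m - r) * (g : ZMod (l ^ m)) ^ k) ∈
        cyclotomicCoset q ((l : ZMod (l ^ m)) ^ (m - r) *
          (g : ZMod (l ^ m)) ^ (k + deltaNum q l r / 2)) := by
  have : NeZero (l ^ m) := ⟨pow_ne_zero _ hl.ne_zero⟩
  have hord := orderOf_unitClass hl hl2 hq1 hq hg hr hrm
  have h1 := hg (-1)
  rw [← mem_powers_iff_mem_zpowers] at h1
  obtain ⟨y, hy⟩ := h1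
  simp only at hy
  have hsq : unitClass hrm hq g ^ (2 * y) = 1 := by
    rw [← map_pow, mul_comm, pow_mul, hy, neg_one_sq, map_one]
  have hne : unitClass hrm hq g ^ y ≠ 1 := by
    rw [← map_pow, hy, ← map_one (unitClass hrm hq)]
    intro h
    rw [eq_comm, ← mem_coset_iff_unitClass hl hrm hq] at h
    obtain ⟨j, hj⟩ := h
    rw [mul_assoc, pow_mul_eq_pow_mul_iff hl hrm, map_mul, map_pow, map_natCast, Units.val_one,
      map_one, Units.val_neg, Units.val_one, map_neg, map_one, one_mul] at hj
    have h2 : (q : ZMod (l ^ r)) ^ (j * 2) = 1 := by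
      rw [pow_mul, ← hj, neg_one_sq]
    rw [pow_eq_one_iff_lambdaOrd_dvd hl hl2 hq1 hq hr] at h2
    have h3 := (Nat.Coprime.dvd_of_dvd_mul_right
      ((Nat.coprime_two_right).2 (odd_lambdaOrd hl2 hf r)) h2)
    rw [← pow_eq_one_iff_lambdaOrd_dvd hl hl2 hq1 hq hr, ← hj] at h3
    exact one_ne_neg_one hl hl2 hr h3.symm
  rw [← orderOf_dvd_iff_pow_eq_one, hord] at hsq
  rw [Ne, ← orderOf_dvd_iff_pow_eq_one, hord] at hne
  -- Here `g ^ y = -1` and `2 * y = δ(r) * c`. An even `c` would make `y` a multiple of `δ(r)`, so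
  -- `c` is odd and `y ≡ δ(r) / 2` modulo `δ(r)`.
  obtain ⟨c, hc⟩ := hsq
  have hcodd : ¬ Even c := by
    rintro ⟨b, rfl⟩
    exact hne ⟨b, by linarith⟩
  rw [Nat.not_even_iff_odd] at hcodd
  have heven : Even (deltaNum q l r) := by
    have : Even (deltaNum q l r * c) := ⟨y, by omega⟩
    exact (Nat.even_mul.1 this).resolve_right (Nat.not_even_iff_odd.2 hcodd)
  refine ⟨heven, fun k => ?_⟩
  obtain ⟨a, ha⟩ := heven
  obtain ⟨b, rfl⟩ := hcodd
  have hyk : -((l : ZMod (l ^ m)) ^ (m - r) * (g : ZMod (l ^ m)) ^ k) =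
      (l : ZMod (l ^ m)) ^ (m - r) * (g : ZMod (l ^ m)) ^ (k + y) := by
    rw [pow_add, ← Units.val_pow_eq_pow_val g y, hy]
    simp
  rw [hyk, pow_mem_coset_iff hl hl2 hq1 hq hg hr hrm]
  have : y = deltaNum q l r / 2 + deltaNum q l r * b := by
    rw [ha] at hc ⊢
    have : (a + a) / 2 = a := by omega
    rw [this]
    linarith
  rw [this, ← add_assoc]
  exact (Nat.ModEq.refl _).symm.trans (by simp [Nat.ModEq])

end OddOrder

end NegacyclicLCD

namespace NegacyclicLCD

/-! ### Orbits of Frobenius and inversion -/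

section Orbits

variable {F K Z : Type*} [Field F] [Fintype F] [Field K] [Algebra F K] {N P : ℕ}

/-- The orbit of `z` under Frobenius. -/
def RootData.frobOrbit (D : RootData F K N P Z) (z : Z) : Set Z := {w | ∃ j, w = D.σ^[j] z}

/-- The orbit of `z` under Frobenius and inversion. -/
def RootData.orbit (D : RootData F K N P Z) (z : Z) : Set Z :=
  {w | w ∈ D.frobOrbit z ∨ D.τ w ∈ D.frobOrbit z}

variable (D : RootData F K N P Z)

theorem RootData.τ_τ (z : Z) : D.τ (D.τ z) = z := D.inj (by rw [D.E_inv, D.E_inv, inv_inv])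

theorem RootData.τ_σ (z : Z) : D.τ (D.σ z) = D.σ (D.τ z) :=
  D.inj (by rw [D.E_inv, D.E_frob, D.E_frob, D.E_inv, inv_pow])

theorem RootData.σ_injective : Function.Injective D.σ := by
  intro z w hzw
  apply D.inj
  apply (FiniteField.frobeniusAlgHom F K : K →+* K).injective
  simpa [D.E_frob] using congrArg D.E hzw

theorem RootData.mem_frobOrbit_self (z : Z) : z ∈ D.frobOrbit z := ⟨0, rfl⟩

theorem RootData.σ_mem_frobOrbit {z w : Z} (h : w ∈ D.frobOrbit z) : D.σ w ∈ D.frobOrbit z := by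
  obtain ⟨j, rfl⟩ := h
  exact ⟨j + 1, (Function.iterate_succ_apply' D.σ j z).symm⟩

theorem RootData.mem_frobOrbit_symm [Finite Z] {z w : Z} (h : w ∈ D.frobOrbit z) :
    z ∈ D.frobOrbit w := by
  obtain ⟨j, rfl⟩ := h
  obtain ⟨n, hn, hz⟩ := D.σ_injective.mem_periodicPts z
  refine ⟨j * (n - 1), ?_⟩
  rw [← Function.iterate_add_apply, show j * (n - 1) + j = n * j by
    obtain ⟨k, rfl⟩ := Nat.exists_eq_succ_of_ne_zero hn.ne'
    rw [Nat.succ_eq_add_one, Nat.add_sub_cancel]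
    ring]
  exact (hz.mul_const j).symm

variable {D}

theorem RootData.Stable.frobOrbit_subset {S : Set Z} (hS : D.Stable S) {z : Z} (hz : z ∈ S) :
    D.frobOrbit z ⊆ S := by
  rintro w ⟨j, rfl⟩
  induction j with
  | zero => exact hz
  | succ j ih =>
    rw [Function.iterate_succ_apply']
    exact (hS _ ih).1

/-- Inversion is an involution commuting with Frobenius, so `orbit` is the full orbit and only the
choice of representatives needs checking. -/
theorem RootData.isOrbitPartition_orbit [Finite Z] {ι : Type*} {z : ι → Z}
    (h : ∀ w, ∃! k, w ∈ D.orbit (z k)) : D.IsOrbitPartition fun k => D.orbit (z k) where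
  partition := h
  nonempty k := ⟨z k, Or.inl (D.mem_frobOrbit_self _)⟩
  stable k w hw := by
    rcases hw with hw | hw
    · exact ⟨Or.inl (D.σ_mem_frobOrbit hw), Or.inr (by rwa [D.τ_τ])⟩
    · exact ⟨Or.inr (by rw [D.τ_σ]; exact D.σ_mem_frobOrbit hw), Or.inl hw⟩
  minimal k S hS w hw hwS := by
    have hz : z k ∈ S := by
      rcases hw with hw | hw
      · exact hS.frobOrbit_subset hwS (D.mem_frobOrbit_symm hw)
      · exact hS.frobOrbit_subset (hS w hwS).2 (D.mem_frobOrbit_symm hw)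
    rintro v (hv | hv)
    · exact hS.frobOrbit_subset hz hv
    · rw [← D.τ_τ v]
      exact (hS _ (hS.frobOrbit_subset hz hv)).2

end Orbits

/-! ### The roots of `X ^ (2 * M) + 1` -/

section Twist

variable {K : Type*} [Field K] {M : ℕ} [NeZero M] {η : K}

omit [NeZero M] in
theorem pow_val_natCast (hη : η ^ M = 1) (k : ℕ) : η ^ (k : ZMod M).val = η ^ k := by
  rw [ZMod.val_natCast, ← pow_eq_pow_mod k hη]

theorem pow_val_natCast_mul (hη : η ^ M = 1) (k : ℕ) (s : ZMod M) :
    η ^ ((k : ZMod M) * s).val = (η ^ s.val) ^ k := by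
  conv_lhs => rw [← ZMod.natCast_zmod_val s]
  rw [← Nat.cast_mul, pow_val_natCast hη, ← pow_mul, mul_comm]

theorem pow_val_neg (hη : η ^ M = 1) (s : ZMod M) : η ^ (-s).val = (η ^ s.val)⁻¹ := by
  apply eq_inv_of_mul_eq_one_left
  rw [← pow_add, ← pow_val_natCast hη]
  simp

theorem pow_val_injective (hη : IsPrimitiveRoot η M) :
    Function.Injective fun s : ZMod M => η ^ s.val := fun s t h =>
  ZMod.val_injective M (hη.pow_inj (ZMod.val_lt s) (ZMod.val_lt t) h)

/-- The two signs `θ` and `-θ`. -/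
def signed (θ : K) (b : Bool) : K := if b then θ else -θ

/-- The parametrization `(b, s) ↦ (±θ)⁻¹ η ^ s` of the roots of `X ^ (2 M) + 1`. -/
noncomputable def twistRoot (η θ : K) (z : Bool × ZMod M) : K :=
  (signed θ z.1)⁻¹ * η ^ z.2.val

omit [NeZero M] in
theorem signed_mul_not {θ : K} (hθ : θ ^ 2 = -1) (b : Bool) :
    signed θ b * signed θ (!b) = 1 := by
  cases b <;> simp [signed, ← sq, hθ]

omit [NeZero M] in
theorem signed_sq {θ : K} (hθ : θ ^ 2 = -1) (b : Bool) : signed θ b ^ 2 = -1 := by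
  cases b <;> simp [signed, hθ]

omit [NeZero M] in
theorem signed_ne_zero {θ : K} (hθ : θ ^ 2 = -1) (b : Bool) : signed θ b ≠ 0 :=
  left_ne_zero_of_mul_eq_one (signed_mul_not hθ b)

/-- The `M`-th power of a root forgets `s` and, since `M` is odd and `2 ≠ 0`, still detects the
sign. -/
theorem twistRoot_injective (hM : Odd M) (h2 : (2 : K) ≠ 0) (hη : IsPrimitiveRoot η M) {θ : K}
    (hθ : θ ^ 2 = -1) : Function.Injective (twistRoot η θ : Bool × ZMod M → K) := by
  rintro ⟨b, s⟩ ⟨c, t⟩ h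
  simp only [twistRoot] at h
  have hpow : ∀ b (s : ZMod M), ((signed θ b)⁻¹ * η ^ s.val) ^ M = (signed θ b ^ M)⁻¹ := by
    intro b s
    rw [mul_pow, ← pow_mul, mul_comm s.val, pow_mul, hη.pow_eq_one, one_pow, mul_one, inv_pow]
  have h0 : θ ≠ 0 := signed_ne_zero hθ true
  have h1 := congrArg (· ^ M) h
  simp only [hpow, inv_inj] at h1
  have hbc : b = c := by
    have hne : θ ^ M ≠ -θ ^ M := fun he => by
      have : (2 : K) * θ ^ M = 0 := by linear_combination he
      exact mul_ne_zero h2 (pow_ne_zero _ h0) this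
    cases b <;> cases c <;> simp [signed, hM.neg_pow] at h1 ⊢
    · exact hne h1.symm
    · exact hne h1
  subst hbc
  rw [pow_val_injective hη (mul_left_cancel₀ (inv_ne_zero (signed_ne_zero hθ b)) h)]

theorem rootPoly_twistRoot_univ (hM : Odd M) (h2 : (2 : K) ≠ 0) (hη : IsPrimitiveRoot η M)
    {θ : K} (hθ : θ ^ 2 = -1) :
    rootPoly (twistRoot η θ : Bool × ZMod M → K) Set.univ = X ^ (2 * M) + 1 := by
  have hM0 : 2 * M ≠ 0 := by have := NeZero.ne M; omega
  have hmonic : (X ^ (2 * M) + 1 : K[X]).Monic := by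
    have := monic_X_pow_add_C (1 : K) hM0
    rwa [C_1] at this
  symm
  refine eq_of_monic_of_dvd_of_natDegree_le (monic_rootPoly _ _) hmonic ?_ ?_
  · rw [← pow_one (rootPoly _ _)]
    refine rootPoly_pow_dvd (twistRoot_injective hM h2 hη hθ) fun z _ => ?_
    rw [pow_one, dvd_iff_isRoot, IsRoot.def]
    simp only [eval_add, eval_pow, eval_X, eval_one, twistRoot]
    rw [mul_pow, inv_pow, pow_mul (signed θ z.1), signed_sq hθ, hM.neg_one_pow, ← pow_mul,
      show z.2.val * (2 * M) = M * (2 * z.2.val) by ring, pow_mul, hη.pow_eq_one]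
    norm_num
  · rw [natDegree_rootPoly, Set.ncard_univ]
    have : (X ^ (2 * M) + 1 : K[X]).natDegree = 2 * M := by
      have := natDegree_X_pow_add_C (n := 2 * M) (r := (1 : K))
      rwa [C_1] at this
    rw [this]
    simp

variable {F : Type*} [Field F] [Fintype F] [Algebra F K]

/-- The roots of `X ^ (2 M p ^ n) + 1` as twists of the `M`-th roots of unity, where Frobenius
changes the sign of `θ` according to `φ`. -/
noncomputable def twistRootData {p : ℕ} [CharP K p] (hp : p.Prime) (n : ℕ) (hM : Odd M)
    (h2 : (2 : K) ≠ 0) (hη : IsPrimitiveRoot η M) {θ : K} (hθ : θ ^ 2 = -1) (φ : Bool → Bool)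
    (hφ : ∀ b, signed θ (φ b) = signed θ b ^ Fintype.card F) :
    RootData F K (2 * M * p ^ n) (p ^ n) (Bool × ZMod M) where
  E := twistRoot η θ
  σ z := (φ z.1, (Fintype.card F : ZMod M) * z.2)
  τ z := (!z.1, -z.2)
  inj := twistRoot_injective hM h2 hη hθ
  E_frob z := by
    simp only [twistRoot]
    rw [hφ, pow_val_natCast_mul hη.pow_eq_one, mul_pow, inv_pow]
  E_inv z := by
    simp only [twistRoot]
    rw [pow_val_neg hη.pow_eq_one, mul_inv, inv_inv]
    congr 1
    exact (eq_inv_of_mul_eq_one_left (signed_mul_not hθ _)).symm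
  N_pos := by
    have := NeZero.pos M
    have := hp.pos
    positivity
  P_pos := pow_pos hp.pos _
  factor := by
    have : Fact p.Prime := ⟨hp⟩
    -- In characteristic `p`, raising to the power `p ^ n` is additive.
    rw [rootPoly_twistRoot_univ hM h2 hη hθ, add_pow_char_pow, one_pow, ← pow_mul]
    simp

omit [NeZero M] [Fintype F] [Algebra F K] [Field F] in
theorem hat_C_mul {f : K[X]} (hf : f.Monic) {c : K} (hc : c ≠ 0) : hat (C c * f) = f := by
  rw [hat, leadingCoeff_mul, leadingCoeff_C, hf.leadingCoeff, mul_one, ← mul_assoc, ← C_mul,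
    inv_mul_cancel₀ hc, C_1, one_mul]

-- Substituting `a * X` divides each root by `a`; `hat` removes the resulting power of `a` in front.
omit [NeZero M] [Fintype F] [Algebra F K] [Field F] in
theorem hat_substMul_rootPoly {Z : Type*} [Finite Z] (E : Z → K) (S : Set Z) {a : K}
    (ha : a ≠ 0) : hat (substMul (rootPoly E S) a) = rootPoly (fun z => a⁻¹ * E z) S := by
  have : substMul (rootPoly E S) a =
      C (a ^ (Set.toFinite S).toFinset.card) * rootPoly (fun z => a⁻¹ * E z) S := by
    rw [substMul, rootPoly_eq_prod, rootPoly_eq_prod, prod_comp, C_pow, ← Finset.prod_const,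
      ← Finset.prod_mul_distrib]
    refine Finset.prod_congr rfl fun z _ => ?_
    rw [sub_comp, X_comp, C_comp, mul_sub, ← C_mul, mul_inv_cancel_left₀ ha]
  rw [this, hat_C_mul (monic_rootPoly _ _) (pow_ne_zero _ ha)]

omit [Fintype F] [Algebra F K] [Field F] in
theorem hat_substMul_signed (S : Set (ZMod M)) {θ : K} (hθ : θ ^ 2 = -1) (b : Bool) :
    hat (substMul (rootPoly (fun s : ZMod M => η ^ s.val) S) (signed θ b)) =
      rootPoly (twistRoot η θ) (Prod.mk b '' S) := by
  rw [hat_substMul_rootPoly _ _ (signed_ne_zero hθ b), rootPoly_image (Prod.mk_right_injective b)]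
  rfl

/-- The set of the `(true, s)` with `s ∈ A` and the `(false, s)` with `s ∈ A'`. -/
def pairSet (A A' : Set (ZMod M)) : Set (Bool × ZMod M) := {z | z.2 ∈ if z.1 then A else A'}

omit [Fintype F] [Algebra F K] [Field F] in
theorem rootPoly_pairSet (A A' : Set (ZMod M)) {θ : K} (hθ : θ ^ 2 = -1) :
    rootPoly (twistRoot η θ) (pairSet A A') =
      hat (substMul (rootPoly (fun s : ZMod M => η ^ s.val) A) θ) *
        hat (substMul (rootPoly (fun s : ZMod M => η ^ s.val) A') (-θ)) := by
  have h1 := hat_substMul_signed (η := η) A hθ true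
  have h2 := hat_substMul_signed (η := η) A' hθ false
  simp only [signed, if_true, Bool.false_eq_true, if_false] at h1 h2
  have hset : pairSet A A' = Prod.mk true '' A ∪ Prod.mk false '' A' := by
    ext ⟨b, s⟩
    cases b <;> simp [pairSet]
  rw [h1, h2, hset, rootPoly_union]
  rw [Set.disjoint_left]
  rintro _ ⟨s, _, rfl⟩ ⟨t, _, h⟩
  simp at h

omit [Fintype F] [Algebra F K] [Field F] in
theorem rootPoly_pairSet_zero {θ : K} (hθ : θ ^ 2 = -1) :
    rootPoly (twistRoot η θ : Bool × ZMod M → K) (pairSet {0} {0}) = X ^ 2 + 1 := by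
  have h0 : θ ≠ 0 := signed_ne_zero hθ true
  have hone : rootPoly (fun s : ZMod M => η ^ s.val) {0} = X - 1 := by
    rw [rootPoly, finprod_mem_singleton]
    simp
  rw [rootPoly_pairSet _ _ hθ, hone, substMul, substMul]
  have h1 : hat ((X - 1 : K[X]).comp (C θ * X)) = X + C θ := by
    have : (X - 1 : K[X]).comp (C θ * X) = C θ * (X + C θ) := by
      rw [mul_add, ← C_mul, ← sq, hθ]
      simp [sub_eq_add_neg]
    rw [this, hat_C_mul (monic_X_add_C θ) h0]
  have h2 : hat ((X - 1 : K[X]).comp (C (-θ) * X)) = X - C θ := by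
    have : (X - 1 : K[X]).comp (C (-θ) * X) = C (-θ) * (X - C θ) := by
      rw [mul_sub, ← C_mul, neg_mul, ← sq, hθ]
      simp
    rw [this, hat_C_mul (monic_X_sub_C θ) (neg_ne_zero.2 h0)]
  have h3 : (C θ) ^ 2 = (-1 : K[X]) := by rw [← C_pow, hθ]; simp
  rw [h1, h2]
  linear_combination -h3

/-- The coset product descends to `F` and vanishes at `η ^ t`, so the minimal polynomial divides it;
conversely the roots of the minimal polynomial are closed under Frobenius. -/
theorem map_mPoly {q : ℕ} (hcard : Fintype.card F = q) (hη : IsPrimitiveRoot η M) (t : ZMod M) :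
    (mPoly F η t).map (algebraMap F K) =
      rootPoly (fun s : ZMod M => η ^ s.val) (cyclotomicCoset q t) := by
  subst hcard
  have hfrob : ∀ s : ZMod M, η ^ ((Fintype.card F : ZMod M) * s).val =
      (η ^ s.val) ^ Fintype.card F := pow_val_natCast_mul hη.pow_eq_one _
  obtain ⟨g, hg⟩ := exists_map_eq_rootPoly (F := F) (pow_val_injective hη)
    (σ := fun s => (Fintype.card F : ZMod M) * s) hfrob
    (S := cyclotomicCoset (Fintype.card F) t) fun z hz => mul_mem_cyclotomicCoset hz
  have hgm : g.Monic := by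
    rw [← Polynomial.monic_map_iff (f := algebraMap F K), hg]
    exact monic_rootPoly _ _
  have hroot : aeval (η ^ t.val) g = 0 := by
    rw [← eval_map_algebraMap, hg, eval_rootPoly_eq_zero_iff]
    exact ⟨t, mem_cyclotomicCoset_self t, rfl⟩
  have hint : IsIntegral F (η ^ t.val) := ⟨g, hgm, by rwa [← aeval_def]⟩
  refine eq_of_monic_of_associated ((minpoly.monic hint).map _) (monic_rootPoly _ _)
    (associated_of_dvd_dvd ?_ ?_)
  · rw [← hg, map_dvd_map']
    exact minpoly.dvd F _ hroot
  · rw [← pow_one (rootPoly _ _)]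
    refine rootPoly_pow_dvd (pow_val_injective hη) ?_
    rintro _ ⟨j, rfl⟩
    rw [pow_one, dvd_iff_isRoot, IsRoot.def, eval_map_algebraMap]
    induction j with
    | zero =>
      rw [pow_zero, mul_one]
      exact minpoly.aeval F (η ^ t.val)
    | succ j ih =>
      rw [pow_succ, ← mul_assoc, mul_comm (t * _), hfrob, aeval_pow_card, ih,
        zero_pow Fintype.card_ne_zero]

omit [NeZero M] [Fintype F] in
theorem map_hat_substMul (f : F[X]) (a : F) :
    (hat (substMul f a)).map (algebraMap F K) =
      hat (substMul (f.map (algebraMap F K)) (algebraMap F K a)) := by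
  have : (substMul f a).map (algebraMap F K) =
      substMul (f.map (algebraMap F K)) (algebraMap F K a) := by
    simp [substMul, Polynomial.map_comp]
  rw [hat, hat, ← this, leadingCoeff_map, Polynomial.map_mul, map_C, map_inv₀]

end Twist

end NegacyclicLCD

namespace NegacyclicLCD

/-! ### From `q`-cosets to `q²`-cosets -/

section SquareCosets

variable {q M : ℕ}

theorem cyclotomicCoset_eq_union (t : ZMod M) :
    cyclotomicCoset q t =
      cyclotomicCoset (q ^ 2) t ∪ cyclotomicCoset (q ^ 2) (t * (q : ZMod M)) := by
  ext s
  constructor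
  · rintro ⟨j, rfl⟩
    obtain ⟨i, rfl | rfl⟩ := Nat.even_or_odd' j
    · exact Or.inl ⟨i, by rw [Nat.cast_pow, pow_mul]⟩
    · exact Or.inr ⟨i, by rw [Nat.cast_pow, pow_succ _ (2 * i), pow_mul]; ring⟩
  · rintro (⟨i, rfl⟩ | ⟨i, rfl⟩)
    · exact ⟨2 * i, by rw [Nat.cast_pow, pow_mul]⟩
    · exact ⟨2 * i + 1, by rw [Nat.cast_pow, pow_succ _ (2 * i), pow_mul]; ring⟩

theorem cyclotomicCoset_zero : cyclotomicCoset q (0 : ZMod M) = {0} := by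
  ext s
  exact mem_cyclotomicCoset_zero

/-- If `j = 2 * a + 1`, then `q = (q ^ 2) ^ (a + 1)`. -/
theorem cyclotomicCoset_sq_eq {j : ℕ} (hj : Odd j) (h : (q : ZMod M) ^ j = 1) (t : ZMod M) :
    cyclotomicCoset (q ^ 2) t = cyclotomicCoset q t := by
  rw [cyclotomicCoset_eq_union (q := q) t, eq_comm, Set.union_eq_left]
  rintro _ ⟨i, rfl⟩
  obtain ⟨a, rfl⟩ := hj
  refine ⟨i + (a + 1), ?_⟩
  rw [Nat.cast_pow, pow_add, ← pow_mul _ 2 (a + 1), show 2 * (a + 1) = 2 * a + 1 + 1 by ring,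
    pow_succ _ (2 * a + 1), h]
  ring

theorem cyclotomicCoset_mul_self [NeZero M] (hq : q.Coprime M) (t : ZMod M) :
    cyclotomicCoset q (t * (q : ZMod M)) = cyclotomicCoset q t := by
  have h : t * (q : ZMod M) ∈ cyclotomicCoset q t := ⟨1, by rw [pow_one]⟩
  ext s
  exact ⟨fun hs => mem_cyclotomicCoset_trans hs h,
    fun hs => mem_cyclotomicCoset_trans hs (mem_cyclotomicCoset_symm hq h)⟩

/-- A common element would make an odd power of `q` fix `t`. -/
theorem disjoint_cyclotomicCoset_sq [NeZero M] (hq : q.Coprime M) {t : ZMod M}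
    (h : ∀ j, t * (q : ZMod M) ^ j = t → Even j) :
    Disjoint (cyclotomicCoset (q ^ 2) t) (cyclotomicCoset (q ^ 2) (t * (q : ZMod M))) := by
  rw [Set.disjoint_left]
  rintro s hs hs'
  obtain ⟨i, hi⟩ := mem_cyclotomicCoset_trans
    (mem_cyclotomicCoset_symm (hq.pow_left 2) hs) hs'
  rw [Nat.cast_pow, ← pow_mul, mul_assoc, ← pow_succ'] at hi
  have := h _ hi.symm
  rw [Nat.even_add_one] at this
  exact this (even_two_mul i)

theorem IsCosetSystem.existsUnique_succ {e : ℕ} {ρ : Fin (e + 1) → ZMod M}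
    (hρ : IsCosetSystem q ρ) {t : ZMod M} (ht : t ≠ 0) :
    ∃! k : Fin e, t ∈ cyclotomicCoset q (ρ k.succ) := by
  obtain ⟨i, hi, hu⟩ := hρ.2 t
  induction i using Fin.cases with
  | zero =>
    rw [hρ.1] at hi
    exact absurd (mem_cyclotomicCoset_zero.1 hi) ht
  | succ k => exact ⟨k, hi, fun j hj => Fin.succ_injective _ (hu _ hj)⟩

theorem IsCosetSystem.succ_ne_zero {e : ℕ} {ρ : Fin (e + 1) → ZMod M}
    (hρ : IsCosetSystem q ρ) (k : Fin e) : ρ k.succ ≠ 0 := by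
  intro h
  exact Fin.succ_ne_zero k ((hρ.2 0).unique (y₁ := k.succ) (y₂ := 0)
    (by rw [h]; exact mem_cyclotomicCoset_self 0)
    (by rw [hρ.1]; exact mem_cyclotomicCoset_self 0))

end SquareCosets

/-! ### The shape of the orbits in each case -/

section Orbits

variable {F K : Type*} [Field F] [Fintype F] [Field K] [Algebra F K] {N P M q : ℕ}
  {D : RootData F K N P (Bool × ZMod M)}

theorem RootData.iterate_σ {φ : Bool → Bool} (hσ : ∀ z, D.σ z = (φ z.1, (q : ZMod M) * z.2))
    (j : ℕ) (z : Bool × ZMod M) : D.σ^[j] z = (φ^[j] z.1, z.2 * (q : ZMod M) ^ j) := by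
  induction j with
  | zero => simp
  | succ j ih =>
    rw [Function.iterate_succ_apply', ih, hσ, Function.iterate_succ_apply']
    congr 1
    simp only
    ring

theorem mem_pairSet {A A' : Set (ZMod M)} {z : Bool × ZMod M} :
    z ∈ pairSet A A' ↔ z.2 ∈ if z.1 then A else A' := Iff.rfl

theorem neg_mem_cyclotomicCoset_iff {s t : ZMod M} :
    -s ∈ cyclotomicCoset q t ↔ s ∈ cyclotomicCoset q (-t) :=
  ⟨fun h => by simpa using neg_mem_cyclotomicCoset h,
    fun h => by simpa using neg_mem_cyclotomicCoset h⟩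

/-- If Frobenius fixes the sign, an orbit consists of two opposite cosets. -/
theorem RootData.orbit_of_fixed (hσ : ∀ z, D.σ z = (z.1, (q : ZMod M) * z.2))
    (hτ : ∀ z, D.τ z = (!z.1, -z.2)) (t : ZMod M) :
    D.orbit (true, t) = pairSet (cyclotomicCoset q t) (cyclotomicCoset q (-t)) := by
  have hfo : ∀ z, z ∈ D.frobOrbit (true, t) ↔ z.1 = true ∧ z.2 ∈ cyclotomicCoset q t := by
    rintro ⟨b, s⟩
    simp only [RootData.frobOrbit, Set.mem_ofPred_eq, RootData.iterate_σ (φ := id) hσ,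
      Function.iterate_id, id, Prod.mk.injEq]
    exact exists_and_left
  ext ⟨b, s⟩
  change _ ∨ _ ↔ _
  rw [hfo, hfo, hτ, mem_pairSet]
  cases b <;> simp [neg_mem_cyclotomicCoset_iff]

/-- If Frobenius changes the sign, its orbits alternate between two `q²`-cosets. -/
theorem RootData.frobOrbit_of_not (hσ : ∀ z, D.σ z = (!z.1, (q : ZMod M) * z.2))
    (z w : Bool × ZMod M) :
    w ∈ D.frobOrbit z ↔ w.2 ∈ if w.1 = z.1 then cyclotomicCoset (q ^ 2) z.2 else
      cyclotomicCoset (q ^ 2) (z.2 * (q : ZMod M)) := by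
  have hinv : Function.Involutive Bool.not := Bool.not_not
  obtain ⟨c, t⟩ := z
  obtain ⟨b, s⟩ := w
  simp only [RootData.frobOrbit, Set.mem_ofPred_eq, RootData.iterate_σ (φ := Bool.not) hσ,
    Prod.mk.injEq]
  constructor
  · rintro ⟨j, rfl, rfl⟩
    obtain ⟨i, rfl | rfl⟩ := Nat.even_or_odd' j
    · rw [hinv.iterate_even (even_two_mul i), id, if_pos rfl]
      exact ⟨i, by rw [Nat.cast_pow, pow_mul]⟩
    · rw [hinv.iterate_odd (odd_two_mul_add_one i), if_neg (by simp)]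
      exact ⟨i, by rw [Nat.cast_pow, pow_succ _ (2 * i), pow_mul]; ring⟩
  · split_ifs with h
    · rintro ⟨i, rfl⟩
      refine ⟨2 * i, ?_, by rw [Nat.cast_pow, pow_mul]⟩
      rw [hinv.iterate_even (even_two_mul i), id, h]
    · rintro ⟨i, rfl⟩
      refine ⟨2 * i + 1, ?_, by rw [Nat.cast_pow, pow_succ _ (2 * i), pow_mul]; ring⟩
      rw [hinv.iterate_odd (odd_two_mul_add_one i)]
      cases b <;> cases c <;> simp_all

variable [NeZero M] (hq : q.Coprime M) (hσ : ∀ z, D.σ z = (!z.1, (q : ZMod M) * z.2))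
  (hτ : ∀ z, D.τ z = (!z.1, -z.2))
include hq hσ hτ

/-- Here `q`- and `q²`-cosets coincide, so both signs occur over every element of the coset. -/
theorem RootData.orbit_of_odd_pow_eq_one {j : ℕ} (hj : Odd j) (h : (q : ZMod M) ^ j = 1)
    (b : Bool) (t : ZMod M) :
    D.orbit (b, t) = pairSet (cyclotomicCoset q t ∪ cyclotomicCoset q (-t))
      (cyclotomicCoset q t ∪ cyclotomicCoset q (-t)) := by
  ext ⟨c, s⟩
  change _ ∨ _ ↔ _
  rw [RootData.frobOrbit_of_not hσ, RootData.frobOrbit_of_not hσ, hτ, mem_pairSet]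
  simp only [cyclotomicCoset_sq_eq hj h, cyclotomicCoset_mul_self hq, ite_self,
    neg_mem_cyclotomicCoset_iff, Set.mem_union]

-- An odd number `j` of Frobenius steps flips the sign and negates `s`, which is inversion.
omit hq [NeZero M] in
theorem RootData.orbit_of_odd_pow_eq_neg_one {j : ℕ} (hj : Odd j)
    (h : (q : ZMod M) ^ j = -1) (z : Bool × ZMod M) : D.orbit z = D.frobOrbit z := by
  have hinv : Function.Involutive Bool.not := Bool.not_not
  have hτσ : ∀ w, D.τ w = D.σ^[j] w := by
    intro w
    rw [hτ, RootData.iterate_σ (φ := Bool.not) hσ, hinv.iterate_odd hj, h, mul_neg_one]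
  ext w
  refine ⟨?_, Or.inl⟩
  rintro (hw | ⟨i, hi⟩)
  · exact hw
  · refine ⟨j + i, ?_⟩
    rw [Function.iterate_add_apply, ← hi, ← hτσ, D.τ_τ]

-- Now `-1` is a power of `q ^ 2`, so inversion followed by an even number of Frobenius steps flips
-- the sign and keeps `s`.
omit hq [NeZero M] in
theorem RootData.orbit_of_even_pow_eq_neg_one {j : ℕ} (hj : Even j)
    (h : (q : ZMod M) ^ j = -1) (b : Bool) (t : ZMod M) :
    D.orbit (b, t) = pairSet (cyclotomicCoset q t) (cyclotomicCoset q t) := by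
  have hneg : ∀ u : ZMod M, cyclotomicCoset (q ^ 2) (-u) = cyclotomicCoset (q ^ 2) u := by
    have hsub : ∀ u : ZMod M, cyclotomicCoset (q ^ 2) (-u) ⊆ cyclotomicCoset (q ^ 2) u := by
      rintro u _ ⟨i, rfl⟩
      obtain ⟨a, rfl⟩ := hj
      refine ⟨a + i, ?_⟩
      rw [pow_add _ a i, Nat.cast_pow, ← pow_mul _ 2 a, two_mul, h]
      ring
    intro u
    refine (hsub u).antisymm ?_
    have := hsub (-u)
    rwa [neg_neg] at this
  ext ⟨c, s⟩
  change _ ∨ _ ↔ _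
  rw [RootData.frobOrbit_of_not hσ, RootData.frobOrbit_of_not hσ, hτ, mem_pairSet, ite_self,
    cyclotomicCoset_eq_union (q := q)]
  cases b <;> cases c <;>
    simp [neg_mem_cyclotomicCoset_iff, hneg, Set.mem_union, or_comm]

end Orbits

/-! ### Orbit representatives -/

section Partitions

variable {F K : Type*} [Field F] [Fintype F] [Field K] [Algebra F K] {N P M q e : ℕ}
  {D : RootData F K N P (Bool × ZMod M)} [NeZero M]

theorem isOrbitPartition_of_fixed (hσ : ∀ z, D.σ z = (z.1, (q : ZMod M) * z.2))
    (hτ : ∀ z, D.τ z = (!z.1, -z.2)) {ρ : Fin (e + 1) → ZMod M} (hρ : IsCosetSystem q ρ) :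
    D.IsOrbitPartition fun k => D.orbit (true, ρ k) := by
  apply RootData.isOrbitPartition_orbit
  rintro ⟨b, s⟩
  simp only [RootData.orbit_of_fixed hσ hτ, mem_pairSet]
  cases b
  · simpa [← neg_mem_cyclotomicCoset_iff] using hρ.2 (-s)
  · simpa using hρ.2 s

variable (hq : q.Coprime M) (hσ : ∀ z, D.σ z = (!z.1, (q : ZMod M) * z.2))
  (hτ : ∀ z, D.τ z = (!z.1, -z.2))
include hq hσ hτ

theorem isOrbitPartition_of_even_pow {j : ℕ} (hj : Even j) (h : (q : ZMod M) ^ j = -1)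
    {ρ : Fin (e + 1) → ZMod M} (hρ : IsCosetSystem q ρ) :
    D.IsOrbitPartition fun k : Option (Fin e) =>
      D.orbit (true, k.elim 0 fun k => ρ k.succ) := by
  apply RootData.isOrbitPartition_orbit
  rintro ⟨b, s⟩
  simp only [RootData.orbit_of_even_pow_eq_neg_one hσ hτ hj h, mem_pairSet, ite_self]
  by_cases hs : s = 0
  · subst hs
    refine ⟨none, mem_cyclotomicCoset_self 0, ?_⟩
    rintro (_ | k) hk
    · rfl
    · exact absurd (mem_cyclotomicCoset_zero.1 (mem_cyclotomicCoset_symm hq hk))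
        (hρ.succ_ne_zero k)
  · obtain ⟨k, hk, hu⟩ := hρ.existsUnique_succ hs
    refine ⟨some k, hk, ?_⟩
    rintro (_ | k') hk'
    · exact absurd (mem_cyclotomicCoset_zero.1 hk') hs
    · rw [hu k' hk']

/-- Over a nonzero coset the two signs at `ρ k` lie in different orbits, as its two `q²`-cosets are
disjoint. Over zero they form one orbit, indexed by `none`. -/
theorem isOrbitPartition_of_odd_pow {j : ℕ} (hj : Odd j) (h : (q : ZMod M) ^ j = -1)
    (hev : ∀ t : ZMod M, t ≠ 0 → ∀ j, t * (q : ZMod M) ^ j = t → Even j)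
    {ρ : Fin (e + 1) → ZMod M} (hρ : IsCosetSystem q ρ) :
    D.IsOrbitPartition fun k : Option (Fin e × Bool) =>
      D.orbit (k.elim (true, 0) fun k => (k.2, ρ k.1.succ)) := by
  apply RootData.isOrbitPartition_orbit
  rintro ⟨b, s⟩
  simp only [RootData.orbit_of_odd_pow_eq_neg_one hσ hτ hj h, RootData.frobOrbit_of_not hσ]
  have hsub : ∀ (c : Bool) (t : ZMod M), (s ∈ if b = c then cyclotomicCoset (q ^ 2) t else
      cyclotomicCoset (q ^ 2) (t * (q : ZMod M))) → s ∈ cyclotomicCoset q t := by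
    intro c t hs
    rw [cyclotomicCoset_eq_union]
    split_ifs at hs
    · exact Or.inl hs
    · exact Or.inr hs
  by_cases hs : s = 0
  · subst hs
    refine ⟨none, ?_, ?_⟩
    · simp [cyclotomicCoset_zero]
    · rintro (_ | k) hk
      · rfl
      · exact absurd (mem_cyclotomicCoset_zero.1 (mem_cyclotomicCoset_symm hq (hsub _ _ hk)))
          (hρ.succ_ne_zero k.1)
  · obtain ⟨k, hk, hu⟩ := hρ.existsUnique_succ hs
    have hdis := Set.disjoint_left.1
      (disjoint_cyclotomicCoset_sq hq (hev _ (hρ.succ_ne_zero k)))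
    have huniq : ∀ c : Bool, (s ∈ if b = c then cyclotomicCoset (q ^ 2) (ρ k.succ) else
        cyclotomicCoset (q ^ 2) (ρ k.succ * (q : ZMod M))) → ∀ c' : Bool,
        (s ∈ if b = c' then cyclotomicCoset (q ^ 2) (ρ k.succ) else
        cyclotomicCoset (q ^ 2) (ρ k.succ * (q : ZMod M))) → c' = c := by
      intro c hc c' hc'
      by_contra hne
      by_cases hbc : b = c
      · rw [if_pos hbc] at hc
        rw [if_neg fun h => hne (h.symm.trans hbc)] at hc'
        exact hdis hc hc'
      · have : b = c' := by cases b <;> cases c <;> cases c' <;> simp_all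
        rw [if_neg hbc] at hc
        rw [if_pos this] at hc'
        exact hdis hc' hc
    obtain ⟨c, hc⟩ : ∃ c : Bool, s ∈ if b = c then cyclotomicCoset (q ^ 2) (ρ k.succ) else
        cyclotomicCoset (q ^ 2) (ρ k.succ * (q : ZMod M)) := by
      rw [cyclotomicCoset_eq_union] at hk
      rcases hk with hk | hk
      · exact ⟨b, by rwa [if_pos rfl]⟩
      · exact ⟨!b, by rwa [if_neg (by simp)]⟩
    refine ⟨some (k, c), hc, ?_⟩
    rintro (_ | ⟨k', c'⟩) hk'
    · exact absurd (mem_cyclotomicCoset_zero.1 (hsub _ _ hk')) hs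
    · obtain rfl := hu k' (hsub _ _ hk')
      rw [huniq c hc c' hk']

end Partitions

/-! ### Orbit representatives when `f` is odd -/

section OddPartition

variable {q l m : ℕ} {g : (ZMod (l ^ m))ˣ}

/-- Negation shifts the exponent of `g` by `δ(r) / 2`, so the pairs of opposite cosets of level `r`
are labelled by exponents modulo `δ(r) / 2`. -/
theorem existsUnique_half_cosetRep (hl : l.Prime) (hl2 : Odd l) (hq1 : 1 < q) (hq : q.Coprime l)
    (hg : ∀ x, x ∈ Subgroup.zpowers g) (hf : Odd (ordMod q l)) {t : ZMod (l ^ m)} (ht : t ≠ 0) :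
    ∃! i : CosetIndex m (fun r => deltaNum q l r / 2),
      t ∈ cyclotomicCoset q (cosetRep g i) ∪ cyclotomicCoset q (-cosetRep g i) := by
  have : NeZero (l ^ m) := ⟨pow_ne_zero _ hl.ne_zero⟩
  obtain ⟨⟨r, ⟨k, hk⟩⟩, hi, hu⟩ := existsUnique_cosetRep hl hl2 hq1 hq hg ht
  obtain ⟨hr1, hr2⟩ := Finset.mem_Icc.1 r.2
  -- a half index determines two full indices
  have key : ∀ i : CosetIndex m (fun r => deltaNum q l r / 2),
      t ∈ cyclotomicCoset q (cosetRep g i) ∪ cyclotomicCoset q (-cosetRep g i) ↔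
      ∃ x : Fin (deltaNum q l i.1), t ∈ cyclotomicCoset q
        (cosetRep g (⟨i.1, x⟩ : CosetIndex m (deltaNum q l))) ∧
        ((x : ℕ) = i.2 ∨ (x : ℕ) = i.2 + deltaNum q l i.1 / 2) := by
    rintro ⟨r, ⟨k, hk⟩⟩
    simp only at hk
    obtain ⟨hr1, hr2⟩ := Finset.mem_Icc.1 r.2
    obtain ⟨-, hneg⟩ := exists_neg_eq hl hl2 hq1 hq hg hf hr1 hr2
    have h1 : t ∈ cyclotomicCoset q
        (-cosetRep g (d := fun r => deltaNum q l r / 2) ⟨r, ⟨k, hk⟩⟩) ↔ t ∈ cyclotomicCoset q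
        (cosetRep g (⟨r, ⟨k + deltaNum q l r / 2, by omega⟩⟩ : CosetIndex m (deltaNum q l))) :=
      ⟨fun h => mem_cyclotomicCoset_trans h (hneg k), fun h => mem_cyclotomicCoset_trans h
        (mem_cyclotomicCoset_symm (hq.pow_right m) (hneg k))⟩
    rw [Set.mem_union, h1]
    constructor
    · rintro (h | h)
      · exact ⟨⟨k, show k < deltaNum q l r by omega⟩, h, Or.inl rfl⟩
      · exact ⟨⟨k + deltaNum q l r / 2, show _ < deltaNum q l r by omega⟩, h, Or.inr rfl⟩
    · rintro ⟨⟨x, hx⟩, h, h'⟩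
      simp only at h'
      rcases h' with rfl | rfl
      · exact Or.inl h
      · exact Or.inr h
  obtain ⟨⟨a, ha⟩, -⟩ := exists_neg_eq hl hl2 hq1 hq hg hf hr1 hr2
  have hlt : k % (deltaNum q l r / 2) < deltaNum q l r / 2 := Nat.mod_lt _ (by omega)
  refine ⟨⟨r, ⟨k % (deltaNum q l r / 2), hlt⟩⟩, (key _).2 ⟨⟨k, hk⟩, hi, ?_⟩, ?_⟩
  · simp only
    by_cases h : k < deltaNum q l r / 2
    · exact Or.inl (Nat.mod_eq_of_lt h).symm
    · right
      rw [Nat.mod_eq_sub_mod (by omega), Nat.mod_eq_of_lt (by omega)]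
      omega
  · rintro ⟨r', ⟨k', hk'⟩⟩ h
    obtain ⟨⟨x, hx⟩, hxt, hxk⟩ := (key _).1 h
    have := hu _ hxt
    simp only [Sigma.mk.injEq] at this
    obtain ⟨rfl, h2⟩ := this
    have h3 : x = k := by simpa using h2
    subst h3
    simp only at hxk
    have : k' = x % (deltaNum q l r' / 2) := by
      rcases hxk with h | h
      · rw [h, Nat.mod_eq_of_lt hk']
      · rw [h, Nat.add_mod_right, Nat.mod_eq_of_lt hk']
    subst this
    rfl

variable {F K : Type*} [Field F] [Fintype F] [Field K] [Algebra F K] {N P : ℕ}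
  {D : RootData F K N P (Bool × ZMod (l ^ m))}

theorem isOrbitPartition_of_odd_order (hl : l.Prime) (hl2 : Odd l) (hq1 : 1 < q)
    (hq : q.Coprime l) (hg : ∀ x, x ∈ Subgroup.zpowers g) (hf : Odd (ordMod q l)) (hm : 0 < m)
    (hσ : ∀ z, D.σ z = (!z.1, (q : ZMod (l ^ m)) * z.2)) (hτ : ∀ z, D.τ z = (!z.1, -z.2)) :
    D.IsOrbitPartition fun i : Option (CosetIndex m (fun r => deltaNum q l r / 2)) =>
      D.orbit (true, i.elim 0 (cosetRep g)) := by
  have : NeZero (l ^ m) := ⟨pow_ne_zero _ hl.ne_zero⟩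
  have hqM := hq.pow_right m
  apply RootData.isOrbitPartition_orbit
  rintro ⟨b, s⟩
  simp only [RootData.orbit_of_odd_pow_eq_one hqM hσ hτ (odd_lambdaOrd hl2 hf m)
    ((pow_eq_one_iff_lambdaOrd_dvd hl hl2 hq1 hq hm _).2 dvd_rfl), mem_pairSet, ite_self]
  by_cases hs : s = 0
  · subst hs
    refine ⟨none, Or.inl (mem_cyclotomicCoset_self 0), ?_⟩
    rintro (_ | k) hk
    · rfl
    · exfalso
      rcases hk with hk | hk
      · exact cosetRep_ne_zero hl k
          (mem_cyclotomicCoset_zero.1 (mem_cyclotomicCoset_symm hqM hk))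
      · exact cosetRep_ne_zero hl k (neg_eq_zero.1
          (mem_cyclotomicCoset_zero.1 (mem_cyclotomicCoset_symm hqM hk)))
  · obtain ⟨k, hk, hu⟩ := existsUnique_half_cosetRep hl hl2 hq1 hq hg hf hs
    refine ⟨some k, hk, ?_⟩
    rintro (_ | k') hk'
    · simp [cyclotomicCoset_zero, hs] at hk'
    · rw [hu k' hk']

/-- The cosets of `t` and `-t` differ if `q` has odd order modulo `l`. -/
theorem disjoint_cyclotomicCoset_neg (hl : l.Prime) (hl2 : Odd l) (hq1 : 1 < q)
    (hq : q.Coprime l) (hf : Odd (ordMod q l)) {t : ZMod (l ^ m)} (ht : t ≠ 0) :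
    Disjoint (cyclotomicCoset q t) (cyclotomicCoset q (-t)) := by
  have : NeZero (l ^ m) := ⟨pow_ne_zero _ hl.ne_zero⟩
  rw [Set.disjoint_left]
  intro s hs hs'
  obtain ⟨j, hj⟩ := mem_cyclotomicCoset_trans
    (mem_cyclotomicCoset_symm (hq.pow_right m) hs) hs'
  obtain ⟨r, hr, hrm, u, rfl⟩ := exists_eq_pow_mul_unit hl ht
  rw [neg_mul, mul_assoc, ← mul_neg, pow_mul_eq_pow_mul_iff hl hrm, map_neg, map_mul, map_pow,
    map_natCast, ← mul_neg] at hj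
  have hu := u.isUnit.map (ZMod.castHom (pow_dvd_pow l hrm) (ZMod (l ^ r)))
  have h1 : (1 : ZMod (l ^ r)) = -(q : ZMod (l ^ r)) ^ j :=
    hu.mul_left_cancel ((mul_one _).trans hj)
  have h2 : (q : ZMod (l ^ r)) ^ (j * 2) = 1 := by
    rw [pow_mul, ← neg_sq, ← h1, one_pow]
  rw [pow_eq_one_iff_lambdaOrd_dvd hl hl2 hq1 hq hr] at h2
  have h3 := (Nat.Coprime.dvd_of_dvd_mul_right
    ((Nat.coprime_two_right).2 (odd_lambdaOrd hl2 hf r)) h2)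
  rw [← pow_eq_one_iff_lambdaOrd_dvd hl hl2 hq1 hq hr] at h3
  rw [h3] at h1
  exact one_ne_neg_one hl hl2 hr h1

end OddPartition

end NegacyclicLCD

namespace NegacyclicLCD

/-! ### The listed polynomials as orbit polynomials -/

section PairPolys

variable {K : Type*} [Field K] {M : ℕ} [NeZero M] {η θ : K} {q : ℕ}

theorem rootPoly_pairSet_union {Z : Type*} [Field Z] (E : Bool × ZMod M → Z)
    {A A' B B' : Set (ZMod M)} (h : Disjoint A B) (h' : Disjoint A' B') :
    rootPoly E (pairSet (A ∪ B) (A' ∪ B')) =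
      rootPoly E (pairSet A A') * rootPoly E (pairSet B B') := by
  rw [← rootPoly_union]
  · congr 1
    ext ⟨b, s⟩
    cases b <;> simp [pairSet]
  · rw [Set.disjoint_left] at h h' ⊢
    rintro ⟨b, s⟩
    cases b
    · simpa [pairSet] using @h' s
    · simpa [pairSet] using @h s

theorem sPoly_eq_rootPoly (hθ : θ ^ 2 = -1) (t : ZMod M) :
    sPoly q η θ t = rootPoly (twistRoot η θ) (pairSet (cyclotomicCoset (q ^ 2) t)
      (cyclotomicCoset (q ^ 2) (t * (q : ZMod M)))) :=
  (rootPoly_pairSet _ _ hθ).symm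

theorem sPoly_neg_eq_rootPoly (hθ : θ ^ 2 = -1) (t : ZMod M) :
    sPoly q η (-θ) t = rootPoly (twistRoot η θ) (pairSet
      (cyclotomicCoset (q ^ 2) (t * (q : ZMod M))) (cyclotomicCoset (q ^ 2) t)) := by
  rw [rootPoly_pairSet _ _ hθ, mul_comm, sPoly, neg_neg]
  rfl

variable {F : Type*} [Field F] [Fintype F] [Algebra F K]

theorem pairPoly_eq_rootPoly (hcard : Fintype.card F = q) (hη : IsPrimitiveRoot η M)
    (hθ : θ ^ 2 = -1) (t : ZMod M) :
    pairPoly F η θ t = rootPoly (twistRoot η θ) (pairSet (cyclotomicCoset q t)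
      (cyclotomicCoset q t)) := by
  rw [rootPoly_pairSet _ _ hθ, pairPoly, map_mPoly hcard hη]

end PairPolys

/-! ### Fourth roots of unity and twists -/

section Arithmetic

theorem pow_eq_self_of_sq {K : Type*} [Field K] {x : K} (hx : x ^ 2 = -1) {q : ℕ}
    (hq : q % 4 = 1) : x ^ q = x := by
  rw [← Nat.div_add_mod q 4, hq, pow_succ, pow_mul, show x ^ 4 = 1 by
    rw [show 4 = 2 * 2 from rfl, pow_mul, hx]; norm_num, one_pow, one_mul]

theorem pow_eq_neg_of_sq {K : Type*} [Field K] {x : K} (hx : x ^ 2 = -1) {q : ℕ}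
    (hq : q % 4 = 3) : x ^ q = -x := by
  rw [← Nat.div_add_mod q 4, hq, pow_add, pow_mul, show x ^ 4 = 1 by
    rw [show 4 = 2 * 2 from rfl, pow_mul, hx]; norm_num, one_pow, one_mul, pow_succ, hx,
    neg_one_mul]

/-- As `x` has fourth power 1, `x ^ L` depends on `L` modulo 4 only; `-x` works for `L ≡ 1` and `x`
for `L ≡ 3`. -/
theorem exists_isTwist {K : Type*} [Field K] {x : K} (hx : x ^ 2 = -1) {L : ℕ} (hL : Odd L) :
    ∃ θ : K, IsTwist L x θ := by
  have hinv : x⁻¹ = -x := inv_eq_of_mul_eq_one_right (by linear_combination -hx)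
  have h4 : L % 4 = 1 ∨ L % 4 = 3 := by
    obtain ⟨k, rfl⟩ := hL
    omega
  rcases h4 with h | h
  · refine ⟨-x, ?_, by rw [inv_neg, hinv]⟩
    rw [pow_eq_self_of_sq (by rwa [neg_sq]) h]
    linear_combination -hx
  · refine ⟨x, ?_, hinv⟩
    rw [pow_eq_neg_of_sq hx h]
    linear_combination -hx

/-- This is all that the orbit description needs to know about a twist. -/
theorem IsTwist.sq_eq {K : Type*} [Field K] {L : ℕ} (hL : 0 < L) {x θ : K}
    (h : IsTwist L x θ) : θ ^ 2 = -1 := by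
  have h0 : θ ≠ 0 := by
    rintro rfl
    have := h.1
    rw [zero_pow hL.ne', zero_mul] at this
    exact zero_ne_one this
  have := mul_inv_cancel₀ h0
  rw [h.2] at this
  linear_combination -this

theorem sq_eq_neg_one_of_primitive {K : Type*} [Field K] {γ : K} (h : IsPrimitiveRoot γ 4) :
    γ ^ 2 = -1 := by
  have h1 : γ ^ 2 ≠ 1 := h.pow_ne_one_of_pos_of_lt (by norm_num) (by norm_num)
  have h2 : (γ ^ 2 - 1) * (γ ^ 2 + 1) = 0 := by
    linear_combination h.pow_eq_one
  rcases mul_eq_zero.1 h2 with h3 | h3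
  · exact absurd (sub_eq_zero.1 h3) h1
  · exact eq_neg_of_add_eq_zero_left h3

theorem coprime_card {F : Type*} [Field F] [Fintype F] {p q l : ℕ} (hp : p.Prime) [CharP F p]
    (hq : Fintype.card F = q) (hl : l.Prime) (hlp : l ≠ p) : q.Coprime l := by
  obtain ⟨k, -, hk⟩ := FiniteField.card F p
  rw [← hq, hk]
  exact Nat.Coprime.pow_left _ ((Nat.coprime_primes hp hl).2 hlp.symm)

theorem two_ne_zero_of_odd_char {K : Type*} [Field K] {p : ℕ} (hp : p.Prime) (hp2 : Odd p)
    [CharP K p] : (2 : K) ≠ 0 := by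
  intro h
  have h1 : ((2 : ℕ) : K) = 0 := by exact_mod_cast h
  rw [CharP.cast_eq_zero_iff K p, Nat.prime_dvd_prime_iff_eq hp Nat.prime_two] at h1
  subst h1
  exact absurd hp2 (by decide)

end Arithmetic

/-! ### The four cases -/

section Cases

variable {F K : Type*} [Field F] [Fintype F] [Field K] [Algebra F K] {p q l m : ℕ}

omit [Fintype F] in
/-- A set of polynomials over `F` may be tested by its image over `K`. -/
theorem GeneratesLCDNegacyclic.of_map {N : ℕ} {𝒢 : Set F[X]}
    (h : GeneratesLCDNegacyclic F N (Polynomial.map (algebraMap F K) '' 𝒢)) :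
    GeneratesLCDNegacyclic F N 𝒢 := by
  have key : ∀ (Γ : Submodule F (Fin N → F)) (G : F[X]),
      HasGeneratorPolynomial Γ (G.map (algebraMap F K)) → HasGeneratorPolynomial Γ G := by
    rintro Γ G ⟨g, hg, h⟩
    obtain rfl := map_injective _ (algebraMap F K).injective hg
    exact ⟨g, by simp, h⟩
  constructor
  · intro G hG
    obtain ⟨Γ, h1, h2, h3⟩ := h.1 _ ⟨G, hG, rfl⟩
    exact ⟨Γ, h1, h2, key Γ G h3⟩
  · intro Γ h1 h2
    obtain ⟨_, ⟨G, hG, rfl⟩, h3⟩ := h.2 Γ h1 h2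
    exact ⟨G, hG, key Γ G h3⟩

/-- Under the hypotheses of the theorem, the roots of `X ^ N + 1` are parametrized by
`Bool × ZMod (l ^ m)`, and Frobenius fixes or changes the sign of `θ`. -/
theorem exists_rootData (hp : p.Prime) (hp2 : Odd p) [CharP F p] (hq : Fintype.card F = q)
    (hl : l.Prime) (hl2 : Odd l) (n : ℕ) {η : K} (hη : IsPrimitiveRoot η (l ^ m)) {θ : K}
    (hθ : θ ^ 2 = -1) {φ : Bool → Bool} (hφ : ∀ b, signed θ (φ b) = signed θ b ^ q) :
    ∃ D : RootData F K (2 * l ^ m * p ^ n) (p ^ n) (Bool × ZMod (l ^ m)),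
      D.E = twistRoot η θ ∧ (∀ z, D.σ z = (φ z.1, (q : ZMod (l ^ m)) * z.2)) ∧
      ∀ z, D.τ z = (!z.1, -z.2) := by
  subst hq
  have : NeZero (l ^ m) := ⟨pow_ne_zero _ hl.ne_zero⟩
  have : CharP K p := charP_of_injective_algebraMap (algebraMap F K).injective p
  exact ⟨twistRootData hp n hl2.pow (two_ne_zero_of_odd_char hp hp2) hη hθ φ hφ, rfl,
    fun z => rfl, fun z => rfl⟩

theorem signed_pow_of_one {θ : K} (hθ : θ ^ 2 = -1) (hq4 : q % 4 = 1) (b : Bool) :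
    signed θ (id b) = signed θ b ^ q := (pow_eq_self_of_sq (signed_sq hθ b) hq4).symm

theorem signed_pow_of_three {θ : K} (hθ : θ ^ 2 = -1) (hq4 : q % 4 = 3) (b : Bool) :
    signed θ (!b) = signed θ b ^ q := by
  rw [pow_eq_neg_of_sq (signed_sq hθ b) hq4]
  cases b <;> simp [signed]

variable (hp : p.Prime) (hp2 : Odd p) [CharP F p] (hq : Fintype.card F = q) (hl : l.Prime)
  (hl2 : Odd l) (n : ℕ) {η : K} (hη : IsPrimitiveRoot η (l ^ m))
include hp hp2 hq hl hl2 hη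

theorem lcd_of_one_mod_four {θ : K} (hθ : θ ^ 2 = -1) (hq4 : q % 4 = 1) {e : ℕ}
    {ρ : Fin (e + 1) → ZMod (l ^ m)} (hρ : IsCosetSystem q ρ) :
    numLCDNegacyclic F (2 * l ^ m * p ^ n) = 2 ^ (e + 1) ∧
    ∀ β : F, algebraMap F K β = θ → GeneratesLCDNegacyclic F (2 * l ^ m * p ^ n)
      (generatorsOne F η β ρ (p ^ n)) := by
  have : NeZero (l ^ m) := ⟨pow_ne_zero _ hl.ne_zero⟩
  obtain ⟨D, hE, hσ, hτ⟩ := exists_rootData hp hp2 hq hl hl2 n hη hθ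
    (signed_pow_of_one hθ hq4)
  have hD := isOrbitPartition_of_fixed hσ hτ hρ
  refine ⟨by simpa using hD.numLCDNegacyclic_eq, fun β hβ => ?_⟩
  apply GeneratesLCDNegacyclic.of_map (K := K)
  convert hD.generates using 1
  have hblock : ∀ k, rootPoly D.E (D.orbit (true, ρ k)) =
      (hat (substMul (mPoly F η (ρ k)) β) * hat (substMul (mPoly F η (-ρ k)) (-β))).map
        (algebraMap F K) := by
    intro k
    rw [hE, RootData.orbit_of_fixed hσ hτ, rootPoly_pairSet _ _ hθ, Polynomial.map_mul,
      map_hat_substMul, map_hat_substMul, map_mPoly hq hη, map_mPoly hq hη, map_neg, hβ]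
  have hprod : ∀ ε : Fin (e + 1) → ℕ, (∏ i, hat (substMul (mPoly F η (ρ i)) β) ^ ε i *
      hat (substMul (mPoly F η (-ρ i)) (-β)) ^ ε i).map (algebraMap F K) =
      ∏ k, rootPoly D.E (D.orbit (true, ρ k)) ^ ε k := by
    intro ε
    rw [Polynomial.map_prod]
    refine Finset.prod_congr rfl fun k _ => ?_
    rw [hblock, ← mul_pow, Polynomial.map_pow]
  ext G
  constructor
  · rintro ⟨_, ⟨ε, hε, rfl⟩, rfl⟩
    exact ⟨ε, hε, hprod ε⟩
  · rintro ⟨ε, hε, rfl⟩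
    exact ⟨_, ⟨ε, hε, rfl⟩, hprod ε⟩

theorem lcd_of_odd_order (hm : 0 < m) (hql : q.Coprime l) {θ : K} (hθ : θ ^ 2 = -1)
    (hq4 : q % 4 = 3) (hf : Odd (ordMod q l)) {g : (ZMod (l ^ m))ˣ}
    (hg : ∀ x, x ∈ Subgroup.zpowers g) :
    numLCDNegacyclic F (2 * l ^ m * p ^ n) = 2 ^ (1 + eNum q l m / 2) ∧
    GeneratesLCDNegacyclic F (2 * l ^ m * p ^ n) (generatorsOdd F q l m η θ g (p ^ n)) := by
  have : NeZero (l ^ m) := ⟨pow_ne_zero _ hl.ne_zero⟩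
  have hq1 : 1 < q := by omega
  obtain ⟨D, hE, hσ, hτ⟩ := exists_rootData hp hp2 hq hl hl2 n hη hθ
    (signed_pow_of_three hθ hq4)
  have hD := isOrbitPartition_of_odd_order hl hl2 hq1 hql hg hf hm hσ hτ
  have horb := RootData.orbit_of_odd_pow_eq_one (hql.pow_right m) hσ hτ (odd_lambdaOrd hl2 hf m)
    ((pow_eq_one_iff_lambdaOrd_dvd hl hl2 hq1 hql hm _).2 dvd_rfl)
  -- Each `δ(r)` is even, so halving commutes with the sum.
  have hhalf : eNum q l m / 2 = ∑ r ∈ Finset.Icc 1 m, deltaNum q l r / 2 := by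
    have : eNum q l m = 2 * ∑ r ∈ Finset.Icc 1 m, deltaNum q l r / 2 := by
      rw [eNum, Finset.mul_sum]
      refine Finset.sum_congr rfl fun r hr => ?_
      obtain ⟨h1, h2⟩ := Finset.mem_Icc.1 hr
      exact (Nat.two_mul_div_two_of_even (exists_neg_eq hl hl2 hq1 hql hg hf h1 h2).1).symm
    rw [this, Nat.mul_div_cancel_left _ (by norm_num)]
  constructor
  · rw [hD.numLCDNegacyclic_eq, Fintype.card_option, card_cosetIndex, hhalf, add_comm]
  convert hD.generates using 1
  have hnone : rootPoly D.E (D.orbit (true, 0)) = X ^ 2 + 1 := by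
    rw [horb, hE, neg_zero, cyclotomicCoset_zero, Set.union_self, rootPoly_pairSet_zero hθ]
  have hsome : ∀ t : ZMod (l ^ m), t ≠ 0 →
      rootPoly D.E (D.orbit (true, t)) = pairPoly F η θ t * pairPoly F η θ (-t) := by
    intro t ht
    have hdis := disjoint_cyclotomicCoset_neg hl hl2 hq1 hql hf ht
    rw [horb, hE, rootPoly_pairSet_union _ hdis hdis, pairPoly_eq_rootPoly hq hη hθ,
      pairPoly_eq_rootPoly hq hη hθ]
  have hprod : ∀ (ε₀ : ℕ) (ε : ℕ → ℕ → ℕ),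
      (X ^ 2 + 1 : K[X]) ^ ε₀ * ∏ r ∈ Finset.Icc 1 m, ∏ k ∈ Finset.range (deltaNum q l r / 2),
      pairPoly F η θ ((l : ZMod (l ^ m)) ^ (m - r) * (g : ZMod (l ^ m)) ^ k) ^ ε r k *
      pairPoly F η θ (-((l : ZMod (l ^ m)) ^ (m - r) * (g : ZMod (l ^ m)) ^ k)) ^ ε r k =
      ∏ i : Option (CosetIndex m (fun r => deltaNum q l r / 2)),
        rootPoly D.E (D.orbit (true, i.elim 0 (cosetRep g))) ^
          i.elim ε₀ (fun i => ε i.1 i.2) := by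
    intro ε₀ ε
    rw [Fintype.prod_option, Option.elim_none, Option.elim_none, hnone, Fintype.prod_sigma,
      ← Finset.prod_coe_sort (Finset.Icc 1 m)]
    congr 1
    refine Finset.prod_congr rfl fun r _ => ?_
    rw [← Fin.prod_univ_eq_prod_range (fun k => pairPoly F η θ ((l : ZMod (l ^ m)) ^ (m - (r : ℕ)) *
      (g : ZMod (l ^ m)) ^ k) ^ ε r k * pairPoly F η θ (-((l : ZMod (l ^ m)) ^ (m - (r : ℕ)) *
      (g : ZMod (l ^ m)) ^ k)) ^ ε r k)]
    refine Finset.prod_congr rfl fun k _ => ?_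
    rw [Option.elim_some, Option.elim_some, hsome _ (cosetRep_ne_zero hl _), mul_pow]
    rfl
  ext G
  constructor
  · rintro ⟨ε₀, ε, h0, hε, rfl⟩
    refine ⟨_, ?_, hprod ε₀ ε⟩
    rintro (_ | i)
    · exact h0
    · exact hε _ _
  · rintro ⟨ε, hε, rfl⟩
    -- Exponents outside the index range do not enter the product; 0 is an admissible filler.
    refine ⟨ε none, fun r k => if h : r ∈ Finset.Icc 1 m ∧ k < deltaNum q l r / 2 then
      ε (some ⟨⟨r, h.1⟩, ⟨k, h.2⟩⟩) else 0, hε none, fun r k => ?_, ?_⟩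
    · dsimp only
      split_ifs
      · exact hε _
      · exact Or.inl rfl
    · rw [hprod]
      refine Finset.prod_congr rfl fun i _ => ?_
      congr 1
      rcases i with _ | ⟨r, k⟩
      · rfl
      · rw [Option.elim_some, dif_pos ⟨r.2, k.2⟩]

theorem lcd_of_order_two_mod_four (hm : 0 < m) (hql : q.Coprime l) {θ : K} (hθ : θ ^ 2 = -1)
    (hq4 : q % 4 = 3) (hf : ordMod q l % 4 = 2) {e : ℕ} {ρ : Fin (e + 1) → ZMod (l ^ m)}
    (hρ : IsCosetSystem q ρ) :
    numLCDNegacyclic F (2 * l ^ m * p ^ n) = 2 ^ (1 + 2 * e) ∧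
    GeneratesLCDNegacyclic F (2 * l ^ m * p ^ n) (generatorsTwo q η θ ρ (p ^ n)) := by
  have : NeZero (l ^ m) := ⟨pow_ne_zero _ hl.ne_zero⟩
  have hq1 : 1 < q := by omega
  have hev : Even (ordMod q l) := Nat.even_iff.2 (by omega)
  obtain ⟨D, hE, hσ, hτ⟩ := exists_rootData hp hp2 hq hl hl2 n hη hθ
    (signed_pow_of_three hθ hq4)
  have hj := pow_half_lambdaOrd hl hl2 hq1 hql hm hev
  have hjodd : Odd (ordMod q l / 2 * l ^ (m - padicValNat l (q ^ ordMod q l - 1))) :=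
    (Nat.odd_iff.2 (by omega)).mul hl2.pow
  have hD := isOrbitPartition_of_odd_pow (hql.pow_right m) hσ hτ hjodd hj
    (fun t ht j h => hev.trans_dvd (ordMod_dvd_of_mul_pow_eq hl hl2 hq1 hql ht h)) hρ
  have horb := RootData.orbit_of_odd_pow_eq_neg_one hσ hτ hjodd hj
  have htrue : ∀ t, D.orbit (true, t) = pairSet (cyclotomicCoset (q ^ 2) t)
      (cyclotomicCoset (q ^ 2) (t * (q : ZMod (l ^ m)))) := by
    intro t
    ext ⟨b, s⟩
    rw [horb, RootData.frobOrbit_of_not hσ]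
    rfl
  have hfalse : ∀ t, D.orbit (false, t) = pairSet
      (cyclotomicCoset (q ^ 2) (t * (q : ZMod (l ^ m)))) (cyclotomicCoset (q ^ 2) t) := by
    intro t
    ext ⟨b, s⟩
    rw [horb, RootData.frobOrbit_of_not hσ]
    cases b <;> simp [pairSet]
  constructor
  · rw [hD.numLCDNegacyclic_eq]
    simp
    ring
  convert hD.generates using 1
  have hprod : ∀ ε : Option (Fin e × Bool) → ℕ,
      (X ^ 2 + 1 : K[X]) ^ ε none * ∏ k : Fin e, sPoly q η θ (ρ k.succ) ^ ε (some (k, true)) *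
        sPoly q η (-θ) (ρ k.succ) ^ ε (some (k, false)) =
      ∏ i : Option (Fin e × Bool), rootPoly D.E (D.orbit
        (i.elim (true, 0) fun k => (k.2, ρ k.1.succ))) ^ ε i := by
    intro ε
    rw [Fintype.prod_option, Option.elim_none, htrue, hE, zero_mul, cyclotomicCoset_zero,
      rootPoly_pairSet_zero hθ, Fintype.prod_prod_type]
    congr 1
    refine Finset.prod_congr rfl fun k _ => ?_
    rw [Fintype.prod_bool, Option.elim_some, Option.elim_some, htrue, hfalse,
      sPoly_eq_rootPoly hθ, sPoly_neg_eq_rootPoly hθ]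
  ext G
  constructor
  · rintro ⟨ε₀, ε, ε', h0, hε, hε', rfl⟩
    refine ⟨fun i => i.elim ε₀ fun k => if k.2 then ε k.1 else ε' k.1, ?_, by
      rw [← hprod]
      simp⟩
    rintro (_ | ⟨k, _ | _⟩)
    · exact h0
    · exact hε' k
    · exact hε k
  · rintro ⟨ε, hε, rfl⟩
    exact ⟨ε none, fun k => ε (some (k, true)), fun k => ε (some (k, false)), hε _,
      fun k => hε _, fun k => hε _, (hprod ε).symm⟩

theorem lcd_of_order_zero_mod_four (hm : 0 < m) (hql : q.Coprime l) {θ : K} (hθ : θ ^ 2 = -1)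
    (hq4 : q % 4 = 3) (hf : ordMod q l % 4 = 0) {e : ℕ} {ρ : Fin (e + 1) → ZMod (l ^ m)}
    (hρ : IsCosetSystem q ρ) :
    numLCDNegacyclic F (2 * l ^ m * p ^ n) = 2 ^ (1 + e) ∧
    GeneratesLCDNegacyclic F (2 * l ^ m * p ^ n) (generatorsZero q η θ ρ (p ^ n)) := by
  have : NeZero (l ^ m) := ⟨pow_ne_zero _ hl.ne_zero⟩
  have hq1 : 1 < q := by omega
  have hev : Even (ordMod q l) := Nat.even_iff.2 (by omega)
  obtain ⟨D, hE, hσ, hτ⟩ := exists_rootData hp hp2 hq hl hl2 n hη hθ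
    (signed_pow_of_three hθ hq4)
  have hj := pow_half_lambdaOrd hl hl2 hq1 hql hm hev
  have hjeven : Even (ordMod q l / 2 * l ^ (m - padicValNat l (q ^ ordMod q l - 1))) :=
    (Nat.even_iff.2 (by omega)).mul_right _
  have hD := isOrbitPartition_of_even_pow (hql.pow_right m) hσ hτ hjeven hj hρ
  have horb := RootData.orbit_of_even_pow_eq_neg_one hσ hτ hjeven hj
  constructor
  · rw [hD.numLCDNegacyclic_eq]
    simp
    ring
  convert hD.generates using 1
  have hblock : ∀ k : Fin e, rootPoly D.E (D.orbit (true, ρ k.succ)) =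
      sPoly q η θ (ρ k.succ) * sPoly q η (-θ) (ρ k.succ) := by
    intro k
    -- Since `f` is even, the two `q²`-cosets are disjoint, and the two `sPoly` factors split the
    -- orbit without a common root.
    have hdis := disjoint_cyclotomicCoset_sq (hql.pow_right m) (t := ρ k.succ)
      (fun j h => hev.trans_dvd (ordMod_dvd_of_mul_pow_eq hl hl2 hq1 hql (hρ.succ_ne_zero k) h))
    rw [horb, hE, sPoly_eq_rootPoly hθ, sPoly_neg_eq_rootPoly hθ,
      ← rootPoly_pairSet_union _ hdis hdis.symm, Set.union_comm (cyclotomicCoset (q ^ 2) (_ * _)),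
      ← cyclotomicCoset_eq_union]
  have hprod : ∀ ε : Option (Fin e) → ℕ,
      (X ^ 2 + 1 : K[X]) ^ ε none * ∏ k : Fin e, sPoly q η θ (ρ k.succ) ^ ε (some k) *
        sPoly q η (-θ) (ρ k.succ) ^ ε (some k) =
      ∏ i : Option (Fin e), rootPoly D.E (D.orbit
        (true, i.elim 0 fun k => ρ k.succ)) ^ ε i := by
    intro ε
    rw [Fintype.prod_option, Option.elim_none, horb, hE, cyclotomicCoset_zero,
      rootPoly_pairSet_zero hθ]
    congr 1
    refine Finset.prod_congr rfl fun k _ => ?_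
    rw [Option.elim_some, ← hE, hblock, mul_pow]
  ext G
  constructor
  · rintro ⟨ε₀, ε, h0, hε, rfl⟩
    refine ⟨fun i => i.elim ε₀ ε, ?_, by
      rw [← hprod]
      simp⟩
    rintro (_ | k)
    · exact h0
    · exact hε k
  · rintro ⟨ε, hε, rfl⟩
    exact ⟨ε none, fun k => ε (some k), hε _, fun k => hε _, (hprod ε).symm⟩

end Cases

end NegacyclicLCD

theorem mainTheorem6 {F K : Type*} [Field F] [Fintype F] [Field K] [Algebra F K]
    (p q l m n : ℕ) (hp : p.Prime) (hp_odd : Odd p) [CharP F p] (hq : Fintype.card F = q)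
    (hl : l.Prime) (hl_odd : Odd l) (hlp : l ≠ p) (hm : 0 < m)
    (η : K) (hη : IsPrimitiveRoot η (l ^ m)) :
    -- there are exactly `e + 1` cyclotomic cosets
    (∃ ρ : Fin (NegacyclicLCD.eNum q l m + 1) → ZMod (l ^ m), NegacyclicLCD.IsCosetSystem q ρ) ∧
    -- (i)
    (q % 4 = 1 →
      NegacyclicLCD.numLCDNegacyclic F (2 * l ^ m * p ^ n) = 2 ^ (NegacyclicLCD.eNum q l m + 1) ∧
      ∀ γ : F, IsPrimitiveRoot γ 4 →
        (∃ β : F, NegacyclicLCD.IsTwist (l ^ m) γ β) ∧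
        ∀ β : F, NegacyclicLCD.IsTwist (l ^ m) γ β →
          ∀ ρ : Fin (NegacyclicLCD.eNum q l m + 1) → ZMod (l ^ m),
            NegacyclicLCD.IsCosetSystem q ρ →
            NegacyclicLCD.GeneratesLCDNegacyclic F (2 * l ^ m * p ^ n)
              (NegacyclicLCD.generatorsOne F η β ρ (p ^ n))) ∧
    -- (ii)
    (q % 4 = 3 → Odd (NegacyclicLCD.ordMod q l) →
      NegacyclicLCD.numLCDNegacyclic F (2 * l ^ m * p ^ n)
        = 2 ^ (1 + NegacyclicLCD.eNum q l m / 2) ∧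
      ∀ ς : K, ς ^ 2 = -1 →
        (∃ θ : K, NegacyclicLCD.IsTwist (l ^ m) ς θ) ∧
        ∀ θ : K, NegacyclicLCD.IsTwist (l ^ m) ς θ →
          ∀ g : (ZMod (l ^ m))ˣ, (∀ x, x ∈ Subgroup.zpowers g) →
            NegacyclicLCD.GeneratesLCDNegacyclic F (2 * l ^ m * p ^ n)
              (NegacyclicLCD.generatorsOdd F q l m η θ g (p ^ n))) ∧
    -- (iii)
    (q % 4 = 3 → NegacyclicLCD.ordMod q l % 4 = 2 →
      NegacyclicLCD.numLCDNegacyclic F (2 * l ^ m * p ^ n)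
        = 2 ^ (1 + 2 * NegacyclicLCD.eNum q l m) ∧
      ∀ ς : K, ς ^ 2 = -1 →
        (∃ θ : K, NegacyclicLCD.IsTwist (l ^ m) ς θ) ∧
        ∀ θ : K, NegacyclicLCD.IsTwist (l ^ m) ς θ →
          ∀ ρ : Fin (NegacyclicLCD.eNum q l m + 1) → ZMod (l ^ m),
            NegacyclicLCD.IsCosetSystem q ρ →
            NegacyclicLCD.GeneratesLCDNegacyclic F (2 * l ^ m * p ^ n)
              (NegacyclicLCD.generatorsTwo q η θ ρ (p ^ n))) ∧
    -- (iv)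
    (q % 4 = 3 → NegacyclicLCD.ordMod q l % 4 = 0 →
      NegacyclicLCD.numLCDNegacyclic F (2 * l ^ m * p ^ n)
        = 2 ^ (1 + NegacyclicLCD.eNum q l m) ∧
      ∀ ς : K, ς ^ 2 = -1 →
        (∃ θ : K, NegacyclicLCD.IsTwist (l ^ m) ς θ) ∧
        ∀ θ : K, NegacyclicLCD.IsTwist (l ^ m) ς θ →
          ∀ ρ : Fin (NegacyclicLCD.eNum q l m + 1) → ZMod (l ^ m),
            NegacyclicLCD.IsCosetSystem q ρ →
            NegacyclicLCD.GeneratesLCDNegacyclic F (2 * l ^ m * p ^ n)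
              (NegacyclicLCD.generatorsZero q η θ ρ (p ^ n))) := by
  have hql : q.Coprime l := NegacyclicLCD.coprime_card hp hq hl hlp
  have hq1 : 1 < q := hq ▸ Fintype.one_lt_card
  have hL : 0 < l ^ m := pow_pos hl.pos m
  have hsys := NegacyclicLCD.exists_isCosetSystem hl hl_odd hq1 hql m
  obtain ⟨ρ₀, hρ₀⟩ := id hsys
  -- The counts are claimed without any choice of a square root of `-1`, and `K` may contain none;
  -- they are obtained over the algebraic closure.
  have hη' : IsPrimitiveRoot (algebraMap K (AlgebraicClosure K) η) (l ^ m) :=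
    hη.map_of_injective (algebraMap K (AlgebraicClosure K)).injective
  obtain ⟨θ₀, hθ₀⟩ := IsAlgClosed.exists_pow_nat_eq (-1 : AlgebraicClosure K) two_pos
  refine ⟨hsys, fun hq4 => ⟨?_, fun γ hγ => ⟨?_, fun β hβ ρ hρ => ?_⟩⟩,
    fun hq4 hf => ⟨?_, fun ς hς => ⟨?_, fun θ hθ g hg => ?_⟩⟩,
    fun hq4 hf => ⟨?_, fun ς hς => ⟨?_, fun θ hθ ρ hρ => ?_⟩⟩,
    fun hq4 hf => ⟨?_, fun ς hς => ⟨?_, fun θ hθ ρ hρ => ?_⟩⟩⟩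
  · exact (NegacyclicLCD.lcd_of_one_mod_four hp hp_odd hq hl hl_odd n
      hη' hθ₀ hq4 hρ₀).1
  · exact NegacyclicLCD.exists_isTwist (NegacyclicLCD.sq_eq_neg_one_of_primitive hγ) hl_odd.pow
  · refine (NegacyclicLCD.lcd_of_one_mod_four hp hp_odd hq hl hl_odd n
      hη ?_ hq4 hρ).2 β rfl
    rw [← map_pow, hβ.sq_eq hL, map_neg, map_one]
  · obtain ⟨g, hg⟩ := (ZMod.isCyclic_units_of_prime_pow l hl
      (by rintro rfl; exact absurd hl_odd (by decide)) m).exists_generator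
    exact (NegacyclicLCD.lcd_of_odd_order hp hp_odd hq hl hl_odd n
      hη' hm hql hθ₀ hq4 hf hg).1
  · exact NegacyclicLCD.exists_isTwist hς hl_odd.pow
  · exact (NegacyclicLCD.lcd_of_odd_order hp hp_odd hq hl hl_odd n
      hη hm hql (hθ.sq_eq hL) hq4 hf hg).2
  · exact (NegacyclicLCD.lcd_of_order_two_mod_four hp hp_odd hq hl hl_odd n
      hη' hm hql hθ₀ hq4 hf hρ₀).1
  · exact NegacyclicLCD.exists_isTwist hς hl_odd.pow
  · exact (NegacyclicLCD.lcd_of_order_two_mod_four hp hp_odd hq hl hl_odd n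
      hη hm hql (hθ.sq_eq hL) hq4 hf hρ).2
  · exact (NegacyclicLCD.lcd_of_order_zero_mod_four hp hp_odd hq hl hl_odd n
      hη' hm hql hθ₀ hq4 hf hρ₀).1
  · exact NegacyclicLCD.exists_isTwist hς hl_odd.pow
  · exact (NegacyclicLCD.lcd_of_order_zero_mod_four hp hp_odd hq hl hl_odd n
      hη hm hql (hθ.sq_eq hL) hq4 hf hρ).2
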